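/- **Set-up.** Let $F$ be an algebraically closed field and $a=(a_1,\dots,a_n)$ a sequence of positive integers. A (polynomial) model of a diameter four tree of type $a$ over $F$ is a polynomial $\beta\in F[X]$ whose associated covering $\mathbf P^1_F\to\mathbf P^1_F$ is étale outside $\{0,1,\infty\}$ and tamely ramified, such that $\beta^{-1}(0)$ consists of $n$ points with ramification indices $a_1,\dots,a_n$, and such that $\beta^{-1}(1)$ contains a point $x_\beta$ of ramification index $n$, all its other points being unramified. (If $n\ge 2$, $x_\beta$ is the only ramified point above $1$; if $n=1$, $x_\beta$ is a chosen point of $\beta^{-1}(1)$.) Two models $\beta_1,\beta_2$ represent the same tree if $\beta_2(X)=\beta_1(uX+v)$ with $u\in F^*$, $v\in F$. A model is *standard* if $x_\beta=0$; then $\beta=\prod_j(1-x_jX)^{a_j}$ with pairwise distinct $x_j\in F^*$. A standard model is *normalized* if $\beta(1)=0$, *$a_i$-normalized* if $1$ is a zero of $\beta$ of multiplicity $a_i$, and a *Kummer model* if $\sum_j a_jx_j^n=1$. For a tree $\mathcal T$ over $\overline{\mathbf Q}$ let $\mathbf Q(\mathcal T)$ be its field of moduli, $\mathbf Q(\mathcal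 T)^\bullet$ the field generated over $\mathbf Q$ by the zeros of its normalized models, and $\mathbf Q(\mathcal T)^\circ$ the splitting field over $\mathbf Q(\mathcal T)$ of $X^n-\sum_j a_jx_j^n$, where $\prod_j(1-x_jX)^{a_j}$ is a standard model of $\mathcal T$ with coefficients in $\mathbf Q(\mathcal T)$. Let $\mathbf Q(\mathrm{IV}_a)^\bullet$ and $\mathbf Q(\mathrm{IV}_a)^\circ$ be the composita of these fields over all trees $\mathcal T$ of type $a$ over $\overline{\mathbf Q}$. Let $\mathfrak p$ be a maximal ideal of the ring of integers $\mathcal O_K$ of a number field $K\subset\overline{\mathbf Q}$, with local ring $\mathcal O_{\mathfrak p}$ and residue field $k(\mathfrak p)$. A tree of type $a$ over $\overline{\mathbf Q}$ has *good reduction* at $\mathfrak p$ if, for every valuation ring $A$ of $\overline{\mathbf Q}$ with $A\cap K=\mathcal O_{\mathfrak p}$, it has a normalized model in $A[X]$ whose reduction is a normalized model of type $a$ over an algebraic closure of the residue field of $A$. **Theorem 9.5.** Let $a_1,\dots,a_n$ be positive integers, and let $p>n$ be a prime that is regular at infinity: $p$ divides $a_1+\dots+a_n$, but divides none of the sums $\sum_{j\in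 S}a_j$ with $\emptyset\ne S\subsetneq\{1,\dots,n\}$. Fix $i\in\{1,\dots,n\}$ and put $a=(a_1,\dots,a_n)$, $\hat a=(a_1,\dots,\widehat{a_i},\dots,a_n)$. Let $K\subset\overline{\mathbf Q}$ be a number field containing $\mathbf Q(\mathrm{IV}_a)^\bullet$, $\mathbf Q(\mathrm{IV}_{\hat a})^\circ$ and the splitting field of $h(X)=X^{n-1}+(-1)^n(a_1+\dots+a_n)$. Fix a root $x$ of $h$ and a prime $\mathfrak p$ of $\mathcal O_K$ above $p$. Let $D_{\mathfrak p}$ be the group of those $\tau\in\mathrm{Aut}(K/\mathbf Q)$ with $\tau(\mathfrak p)=\mathfrak p$. Then: 1. There is a bijection $\Psi$ from the set of $a_i$-normalized models $\beta\in\overline{\mathbf Q}[X]$ of type $a$ to the set of Kummer models of type $\hat a$ over $\overline{\mathbf Q}$ such that, for every $\tau\in D_{\mathfrak p}$, every extension $\sigma$ of $\tau$ to an automorphism of $\overline{\mathbf Q}$ and every $a_i$-normalized model $\beta$ of type $a$, one has $\Psi({}^\sigma\beta)={}^{\widehat\sigma}\Psi(\beta)$. Here ${}^\sigma\beta$ is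 obtained by applying $\sigma$ to the coefficients of $\beta$, and ${}^{\widehat\sigma}\gamma(X)=({}^\sigma\gamma)\big(\tfrac{\sigma(x)}{x}X\big)$; that is, $\widehat\sigma$ replaces each $y_j$ in $\gamma=\prod_{j\ne i}(1-y_jX)^{a_j}$ by $\tfrac{\sigma(x)}{x}\sigma(y_j)$. 2. Every diameter four tree of type $\hat a$ over $\overline{\mathbf Q}$ has good reduction at $\mathfrak p$. 3. Every Kummer model of type $\hat a$ over $\overline{\mathbf Q}$ has coefficients in $\mathcal O_{\mathfrak p}$, and its reduction modulo $\mathfrak p$ is a Kummer model of type $\hat a$ over an algebraic closure of $k(\mathfrak p)$. -/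

import Mathlib

open Polynomial IsDedekindDomain NumberField Pointwise

noncomputable section

/-- The algebraic closure of `ℚ`. -/
abbrev Qbar : Type := AlgebraicClosure ℚ

section Models

variable {F : Type*} [Field F] {ι : Type*} [Fintype ι]

/-- For `F` algebraically closed, `IsModelAt a β c` says that the polynomial `β`, seen as a covering
`P¹ → P¹` (totally ramified above `∞`, where the index is `deg β`), is a model of a diameter four
tree of type `a = (a_j)` whose distinguished point `x_β` above `1` is `c`. With `n` the number of
entries of `a`, the ramification index of `β` at `c` is `n` (so `c` is the only ramified point above
`1` as soon as `n ≥ 2`). -/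
structure IsModelAt (a : ι → ℕ) (β : F[X]) (c : F) : Prop where
  /-- `β` is étale outside `{0, 1, ∞}`. -/
  etale : ∀ y : F, β.derivative.eval y = 0 → β.eval y = 0 ∨ β.eval y = 1
  /-- The fibre above `0` consists of distinct points `r j`, with ramification indices `a j`. -/
  fibre_zero : ∃ r : ι → F, Function.Injective r ∧
    (∀ y : F, β.eval y = 0 ↔ y ∈ Set.range r) ∧ ∀ j, β.rootMultiplicity (r j) = a j
  /-- In the fibre above `1`, the point `c` has ramification index `n`. -/
  index_one : β.eval c = 1 ∧ (β - 1).rootMultiplicity c = Fintype.card ι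
  /-- The other points above `1` are unramified. -/
  unramified_one : ∀ y : F, y ≠ c → β.eval y = 1 → (β - 1).rootMultiplicity y = 1
  /-- The ramification above `0` is tame. -/
  tame_zero : ∀ j, (a j : F) ≠ 0
  /-- The ramification above `1` is tame. -/
  tame_one : (Fintype.card ι : F) ≠ 0
  /-- The ramification above `∞` is tame. -/
  tame_infty : (β.natDegree : F) ≠ 0

/-- `β` is a (polynomial) model of a diameter four tree of type `a`. -/
def IsModel (a : ι → ℕ) (β : F[X]) : Prop := ∃ c : F, IsModelAt a β c

/-- Two models represent the same diameter four tree when they differ by an automorphism of `P¹`,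
which necessarily fixes `∞`. -/
def SameTree (β γ : F[X]) : Prop := ∃ u v : F, u ≠ 0 ∧ γ = β.comp (C u * X + C v)

/-- A standard model: `x_β = 0`. -/
def IsStandardModel (a : ι → ℕ) (β : F[X]) : Prop := IsModelAt a β 0

/-- A normalized model: `x_β = 0` and `β(1) = 0`. -/
def IsNormalizedModel (a : ι → ℕ) (β : F[X]) : Prop :=
  IsStandardModel a β ∧ β.eval 1 = 0

/-- An `a_i`-normalized model: a normalized model `β = ∏ (1 - x_j X) ^ a_j` that can be written
with `x_i = 1`, that is, whose root `1` has multiplicity `a_i`. -/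
def IsNormalizedModelAt (a : ι → ℕ) (i : ι) (β : F[X]) : Prop :=
  IsNormalizedModel a β ∧ β.rootMultiplicity 1 = a i

/-- `φ_m = ∑ a_j x_j ^ m` for `β = ∏ (1 - x_j X) ^ a_j`: the sum of the `m`-th powers of the inverses
of the roots of `β`, counted with multiplicity. -/
def inversePowerSum (m : ℕ) (β : F[X]) : F := (β.roots.map fun r => r⁻¹ ^ m).sum

/-- A Kummer model: a standard model with `φ_n = 1`, where `n` is the number of entries of `a`. -/
def IsKummerModel (a : ι → ℕ) (β : F[X]) : Prop :=
  IsStandardModel a β ∧ inversePowerSum (Fintype.card ι) β = 1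

end Models

section Fields

variable {ι : Type*} [Fintype ι]

/-- The field of moduli of the diameter four tree over `Qbar` with model `β`: the fixed field of the
automorphisms `σ` such that `β` and its conjugate by `σ` are models of the same tree. -/
def fieldOfModuli (β : Qbar[X]) : IntermediateField ℚ Qbar :=
  IntermediateField.fixedField
    (Subgroup.closure {σ : Qbar ≃ₐ[ℚ] Qbar | SameTree β (β.map (σ : Qbar →+* Qbar))})

/-- The splitting field of the valency class of type `a`: the compositum over all diameter
four trees of type `a` of the fields generated over `ℚ` by the zeros of their normalized models. -/
def classSplittingField (a : ι → ℕ) : IntermediateField ℚ Qbar :=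
  IntermediateField.adjoin ℚ {r : Qbar | ∃ β : Qbar[X], IsNormalizedModel a β ∧ β.eval r = 0}

/-- The compositum over all diameter four trees `T` of type `a` of the splitting fields over the
field of moduli `ℚ(T)` of the polynomials `X ^ n - φ_n(β)`, where `β` is a standard model
of `T` with coefficients in `ℚ(T)`, and `n` is the number of entries of `a`. -/
def classKummerField (a : ι → ℕ) : IntermediateField ℚ Qbar :=
  ⨆ β ∈ {β : Qbar[X] | IsStandardModel a β ∧ ∀ k, β.coeff k ∈ fieldOfModuli β},
    fieldOfModuli β ⊔
      IntermediateField.adjoin ℚ {z : Qbar | z ^ Fintype.card ι = inversePowerSum (Fintype.card ι) β}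

end Fields

section Reduction

variable {ι : Type*} [Fintype ι] (K : IntermediateField ℚ Qbar) [NumberField K]

/-- The local ring `O_𝔭` of the ring of integers of `K` at `𝔭`, as a valuation ring of `K`. -/
abbrev localRingAt (𝔭 : HeightOneSpectrum (𝓞 K)) : ValuationSubring K :=
  (𝔭.valuation K).valuationSubring

/-- The diameter four tree of type `a` with model `β` has good reduction at `𝔭`: it has a normalized
model that is integral above `𝔭` and whose reduction is a normalized model of a diameter four tree of
the same type over an algebraic closure of the residue field. As the normalized models need not have
coefficients in `K`, integrality and reduction are taken with respect to any
valuation ring `A` of `Qbar` above `O_𝔭`; if a normalized model lies in `K[X]`, its being in `A[X]`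
means that it is in `O_𝔭[X]`, and its reduction is its image in `k(𝔭)[X]`. -/
def HasGoodReduction (𝔭 : HeightOneSpectrum (𝓞 K)) (a : ι → ℕ) (β : Qbar[X]) : Prop :=
  ∀ A : ValuationSubring Qbar, A.comap (algebraMap K Qbar) = localRingAt K 𝔭 →
    ∃ B : A[X], SameTree β (B.map (algebraMap A Qbar)) ∧
      IsNormalizedModel a (B.map (algebraMap A Qbar)) ∧
      IsNormalizedModel a
        (B.map (algebraMap A (AlgebraicClosure (IsLocalRing.ResidueField A))))

/-- The polynomial `γ` has coefficients in `O_𝔭`, and its reduction modulo `𝔭` is a Kummer model of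
a diameter four tree of type `a` over an algebraic closure of the residue field `k(𝔭)`. -/
def ReducesToKummerModel (𝔭 : HeightOneSpectrum (𝓞 K)) (a : ι → ℕ) (γ : Qbar[X]) : Prop :=
  ∃ B : (localRingAt K 𝔭)[X],
    B.map ((algebraMap K Qbar).comp (algebraMap (localRingAt K 𝔭) K)) = γ ∧
      IsKummerModel a
        (B.map (algebraMap (localRingAt K 𝔭)
          (AlgebraicClosure (IsLocalRing.ResidueField (localRingAt K 𝔭)))))

end Reduction

/-- The product of the sums `∑_{j ∈ S} a_j` over the nonempty proper subsets `S` of the indices. -/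
def dInfinity {n : ℕ} (a : Fin n → ℕ) : ℕ :=
  ∏ S : Finset (Fin n) with S.Nonempty ∧ S ≠ Finset.univ, ∑ j ∈ S, a j

/-- `p` divides `a_1 + ⋯ + a_n` but not `dInfinity a`. -/
def RegularAtInfinity {n : ℕ} (p : ℕ) (a : Fin n → ℕ) : Prop :=
  p ∣ ∑ j, a j ∧ ¬ p ∣ dInfinity a

/-- The type `(a_1, …, a_n)` with the entry `a_i` left out. -/
def omitEntry {n : ℕ} (a : Fin n → ℕ) (i : Fin n) : {j : Fin n // j ≠ i} → ℕ := fun j => a j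

/-- The polynomial `X ^ (n - 1) + (-1) ^ n (a_1 + ⋯ + a_n)`. -/
def hInfinity {n : ℕ} (a : Fin n → ℕ) : ℚ[X] :=
  X ^ (n - 1) + C ((-1) ^ n * ((∑ j, a j : ℕ) : ℚ))

/-- The action on polynomials induced by the twisted action `t ↦ (σ(x) / x) σ(t)` on `Qbar`:
it sends `∏ (1 - y_j X) ^ a_j` to `∏ (1 - (σ(x) / x) σ(y_j) X) ^ a_j`. -/
def twistedAction (x : Qbar) (σ : Qbar ≃ₐ[ℚ] Qbar) (γ : Qbar[X]) : Qbar[X] :=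
  (γ.map (σ : Qbar →+* Qbar)).comp (C (σ x / x) * X)

end

/-! A standard model with `n` points above `0` is a product `∏ (1 - x_j X) ^ a_j` with distinct
nonzero `x_j` whose weighted power sums `φ_m = ∑ a_j x_j ^ m` vanish for `1 ≤ m < n`. Indeed its
logarithmic derivative is minus the generating series of the `φ_m` (`coe_derivative_treePoly`), so
these equations express the ramification at `0`.

Put `N = n - 1`, `x_i = 1` and `x_j = 1 + x y_j` for `j ≠ i`. Because `x ^ N = (-1) ^ N ∑ a_j`, the
equations become `∑_{j ≠ i} a_j y_j ^ m = (-1) ^ (N + m) x ^ (N - m)` for `1 ≤ m ≤ N`. As `p`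
divides `∑ a_j`, the root `x` reduces to `0` above `𝔭`, and the right-hand sides reduce to `0, …, 0,
1`: the equations of a Kummer model of the shortened type. Normalized models and Kummer models are
thus solutions of two systems with the same reduction.

That reduction is nondegenerate. No partial sum of the remaining weights vanishes modulo `p`, so
solutions are integral (`mem_of_weightedPowerSum_mem`) and have distinct nonzero residues. The
Jacobian is a Vandermonde determinant times the weights and the degrees `m ≤ N < p`. Hence solutions
over the residue field lift (`exists_weightedPowerSum_eq_of_residue`), and uniquely so
(`eq_of_weightedPowerSum_eq_of_residue_eq`). Matching solutions by their residues
(`CongruentModels`) gives the bijection; the same facts give the two statements on reduction.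

For the equivariance, `σ` need not preserve the valuation ring of `Qbar` in which residues are
taken. But the polynomials with inverse roots `y_j` and with inverse roots `z_j` have coefficients
in `K`, where `σ` acts through `τ` and respects `𝔭`. Their congruence is therefore preserved, and
factoring over the residue field recovers the congruence of the coordinates up to a permutation. The
twist `σ(x) / x` comes from `y_j = (x_j - 1) / x`. -/

noncomputable section

/-! ### Weighted power sums: common zeros over a field. -/

section PowerSums

variable {J : Type*} [Fintype J]

/-- The weighted power sum `∑ a_j y_j ^ m`. -/
def weightedPowerSum {R : Type*} [CommSemiring R] (a : J → ℕ) (y : J → R) (m : ℕ) : R :=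
  ∑ j, (a j : R) * y j ^ m

theorem map_weightedPowerSum {R S G : Type*} [CommSemiring R] [CommSemiring S] [FunLike G R S]
    [RingHomClass G R S] (f : G) (a : J → ℕ) (y : J → R) (m : ℕ) :
    f (weightedPowerSum a y m) = weightedPowerSum a (fun j => f (y j)) m := by
  simp [weightedPowerSum, map_sum]

theorem weightedPowerSum_mul {R : Type*} [CommSemiring R] (a : J → ℕ) (c : R) (y : J → R) (m : ℕ) :
    weightedPowerSum a (fun j => c * y j) m = c ^ m * weightedPowerSum a y m := by
  simp only [weightedPowerSum, Finset.mul_sum]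
  exact Finset.sum_congr rfl fun j _ => by ring

theorem weightedPowerSum_comp_perm {R : Type*} [CommSemiring R] (a : J → ℕ) (y : J → R) (m : ℕ)
    (π : Equiv.Perm J) (hπ : ∀ j, a (π j) = a j) :
    weightedPowerSum a (y ∘ π) m = weightedPowerSum a y m := by
  unfold weightedPowerSum
  rw [← Equiv.sum_comp π fun j => (a j : R) * y j ^ m]
  simp [hπ]

theorem sum_mul_eval_eq_zero {R : Type*} [CommRing R] (w y : J → R) (d : ℕ)
    (h : ∀ m < d, ∑ j, w j * y j ^ m = 0) (q : R[X]) (hq : q.natDegree < d) :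
    ∑ j, w j * q.eval (y j) = 0 := by
  simp only [eval_eq_sum_range, Finset.mul_sum]
  rw [Finset.sum_comm]
  refine Finset.sum_eq_zero fun m hm => ?_
  rw [Finset.mem_range] at hm
  rw [← mul_zero (q.coeff m), ← h m (by omega), Finset.mul_sum]
  exact Finset.sum_congr rfl fun j _ => by ring

variable {k : Type*} [Field k]

-- Test the moments against the polynomial vanishing at all nonzero values other than `y j₀`: only
-- the indices with value `y j₀` survive, and their partial sum of weights is nonzero. Counting
-- distinct nonzero values in the bound is what later forces the coordinates to be distinct.
open Classical in
theorem exists_weightedPowerSum_ne_zero (a : J → ℕ) (y : J → k)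
    (hS : ∀ S : Finset J, S.Nonempty → ((∑ j ∈ S, a j : ℕ) : k) ≠ 0) (j₀ : J) (hj₀ : y j₀ ≠ 0) :
    ∃ m, 1 ≤ m ∧ m ≤ ((Finset.univ.image y).erase 0).card ∧ weightedPowerSum a y m ≠ 0 := by
  by_contra! hcon
  set T := (Finset.univ.image y).erase 0 with hT
  have hmem : y j₀ ∈ T := by simp [hT, hj₀]
  let q : k[X] := ∏ t ∈ T.erase (y j₀), (X - C t)
  have hq : q.natDegree < T.card := by
    rw [natDegree_prod_of_monic _ _ fun t _ => monic_X_sub_C t]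
    simp only [natDegree_X_sub_C, Finset.sum_const, smul_eq_mul, mul_one]
    exact Finset.card_erase_lt_of_mem hmem
  -- The weights `a j * y j` shift degrees by one and kill the indices with `y j = 0`.
  have key := sum_mul_eval_eq_zero (fun j => (a j : k) * y j) y T.card (fun m hm => by
    have := hcon (m + 1) (by omega) (by omega)
    rw [← this, weightedPowerSum]
    exact Finset.sum_congr rfl fun j _ => by ring) q hq
  have hzero : ∀ j, y j ≠ y j₀ → (a j : k) * y j * q.eval (y j) = 0 := by
    intro j hj
    by_cases h0 : y j = 0
    · simp [h0]
    · have : q.eval (y j) = 0 := by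
        rw [eval_prod]
        exact Finset.prod_eq_zero (i := y j) (by simp [hT, hj, h0]) (by simp)
      simp [this]
  have hne : q.eval (y j₀) ≠ 0 := by
    rw [eval_prod, Finset.prod_ne_zero_iff]
    intro t ht
    rw [eval_sub, eval_X, eval_C, sub_ne_zero]
    exact (Finset.ne_of_mem_erase ht).symm
  rw [← Finset.sum_filter_add_sum_filter_not Finset.univ (fun j => y j = y j₀),
    Finset.sum_eq_zero (s := Finset.univ.filter fun j => ¬ y j = y j₀)
      (fun j hj => hzero j (by simpa using hj)), add_zero,
    Finset.sum_congr rfl (g := fun j => (a j : k) * (y j₀ * q.eval (y j₀)))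
      (fun j hj => by rw [(Finset.mem_filter.mp hj).2]; ring), ← Finset.sum_mul] at key
  refine hS (Finset.univ.filter fun j => y j = y j₀) ⟨j₀, by simp⟩ ?_
  rw [Nat.cast_sum]
  exact (mul_eq_zero.mp key).resolve_right (mul_ne_zero hj₀ hne)

open Classical in
theorem card_image_erase_zero_le (y : J → k) :
    ((Finset.univ.image y).erase 0).card ≤ Fintype.card J :=
  (Finset.card_le_card (Finset.erase_subset _ _)).trans Finset.card_image_le

/-- If no nonempty partial sum of the weights vanishes, then the first `|J|` weighted power sums have
only the trivial common zero. -/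
theorem eq_zero_of_weightedPowerSum_eq_zero (a : J → ℕ) (y : J → k)
    (hS : ∀ S : Finset J, S.Nonempty → ((∑ j ∈ S, a j : ℕ) : k) ≠ 0)
    (h : ∀ m, 1 ≤ m → m ≤ Fintype.card J → weightedPowerSum a y m = 0) (j : J) : y j = 0 := by
  by_contra hj
  obtain ⟨m, h1, h2, h3⟩ := exists_weightedPowerSum_ne_zero a y hS j hj
  exact h3 (h m h1 (h2.trans (card_image_erase_zero_le y)))

/-- If no nonempty partial sum of the weights vanishes, then the nontrivial common zeros of the first
`|J| - 1` weighted power sums have pairwise distinct nonzero coordinates. -/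
theorem injective_and_ne_zero_of_weightedPowerSum_eq_zero (a : J → ℕ) (y : J → k)
    (hS : ∀ S : Finset J, S.Nonempty → ((∑ j ∈ S, a j : ℕ) : k) ≠ 0)
    (h : ∀ m, 1 ≤ m → m < Fintype.card J → weightedPowerSum a y m = 0) (j₀ : J) (hj₀ : y j₀ ≠ 0) :
    Function.Injective y ∧ ∀ j, y j ≠ 0 := by
  classical
  -- A nonvanishing power sum has degree at least `|J|`, so there are at least `|J|` distinct
  -- nonzero values.
  obtain ⟨m, h1, h2, h3⟩ := exists_weightedPowerSum_ne_zero a y hS j₀ hj₀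
  have hm : Fintype.card J ≤ m := by
    by_contra! hlt
    exact h3 (h m h1 hlt)
  have hle : (Finset.univ.image y).card ≤ Fintype.card J := Finset.card_image_le
  have hcard : ((Finset.univ.image y).erase 0).card = (Finset.univ.image y).card :=
    le_antisymm (Finset.card_le_card (Finset.erase_subset _ _)) (hle.trans (hm.trans h2))
  have h0 : (0 : k) ∉ Finset.univ.image y := by
    intro h0
    have := Finset.card_erase_lt_of_mem h0
    omega
  refine ⟨?_, fun j hj => h0 (by simpa using ⟨j, hj⟩)⟩
  have := Finset.card_image_iff.mp
    (le_antisymm hle (by rw [← hcard]; exact hm.trans h2) : (Finset.univ.image y).card = _)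
  simpa using this

theorem ne_zero_of_weightedPowerSum_eq_one (a : J → ℕ) (y : J → k) {m : ℕ} (hm : m ≠ 0)
    (h : weightedPowerSum a y m = 1) : ∃ j, y j ≠ 0 := by
  by_contra! hy
  simp [weightedPowerSum, hy, hm] at h

/-- Vandermonde: distinct nodes. -/
theorem eq_zero_of_sum_mul_pow_eq_zero (w y : J → k) (hy : Function.Injective y)
    (h : ∀ m < Fintype.card J, ∑ j, w j * y j ^ m = 0) (j₀ : J) : w j₀ = 0 := by
  classical
  let q : k[X] := ∏ j ∈ Finset.univ.erase j₀, (X - C (y j))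
  have hq : q.natDegree < Fintype.card J := by
    rw [natDegree_prod_of_monic _ _ fun t _ => monic_X_sub_C _]
    simp only [natDegree_X_sub_C, Finset.sum_const, smul_eq_mul, mul_one]
    exact Finset.card_erase_lt_of_mem (Finset.mem_univ _)
  have key := sum_mul_eval_eq_zero w y _ h q hq
  rw [Finset.sum_eq_single j₀] at key
  · refine (mul_eq_zero.mp key).resolve_right ?_
    rw [← ne_eq, eval_prod, Finset.prod_ne_zero_iff]
    intro j hj
    rw [eval_sub, eval_X, eval_C, sub_ne_zero]
    exact fun e => Finset.ne_of_mem_erase hj (hy e).symm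
  · intro j _ hj
    rw [eval_prod, Finset.prod_eq_zero (i := j) (by simp [hj]) (by simp), mul_zero]
  · simp

end PowerSums

/-! ### Integrality and uniqueness of solutions over a valuation ring. -/

section Valuation

variable {J : Type*} [Fintype J]

open IsLocalRing

/-- If some coordinate is not integral, divide by the largest one. Its inverse has residue `0`, so
all the power sums reduce to `0`, while one coordinate reduces to `1`; this contradicts
`eq_zero_of_weightedPowerSum_eq_zero`. -/
theorem mem_of_weightedPowerSum_mem {L : Type*} [Field L] (V : ValuationSubring L) (a : J → ℕ)
    (hS : ∀ S : Finset J, S.Nonempty → ((∑ j ∈ S, a j : ℕ) : ResidueField V) ≠ 0) (y : J → L)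
    (h : ∀ m, 1 ≤ m → m ≤ Fintype.card J → weightedPowerSum a y m ∈ V) (j : J) : y j ∈ V := by
  have : Nonempty J := ⟨j⟩
  obtain ⟨j₀, hj₀⟩ := Finite.exists_max fun j => V.valuation (y j)
  by_contra hj
  have hlt : 1 < V.valuation (y j₀) := by
    rw [← V.valuation_le_one_iff, not_le] at hj
    exact hj.trans_le (hj₀ j)
  have hy0 : y j₀ ≠ 0 := fun e => by simp [e] at hlt
  have hu : V.valuation (y j₀)⁻¹ < 1 := by
    rw [map_inv₀]
    exact inv_lt_one_of_one_lt₀ hlt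
  let u : V := ⟨(y j₀)⁻¹, (V.valuation_le_one_iff _).mp hu.le⟩
  have hu' : residue V u = 0 := by
    rw [residue_eq_zero_iff, V.valuation_lt_one_iff]
    exact hu
  let z : J → V := fun j => ⟨(y j₀)⁻¹ * y j, by
    rw [← V.valuation_le_one_iff, map_mul, map_inv₀]
    exact (inv_mul_le_one₀ (zero_lt_one.trans hlt)).mpr (hj₀ j)⟩
  have hz := eq_zero_of_weightedPowerSum_eq_zero a (fun j => residue V (z j)) hS (fun m h1 h2 => by
    rw [← map_weightedPowerSum]
    have : weightedPowerSum a z m = u ^ m * ⟨weightedPowerSum a y m, h m h1 h2⟩ := by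
      apply Subtype.ext
      have e := map_weightedPowerSum V.subtype a z m
      change V.subtype _ = _
      rw [e]
      exact weightedPowerSum_mul a (y j₀)⁻¹ y m
    rw [this, map_mul, map_pow, hu', zero_pow (by omega), zero_mul]) j₀
  have h1 : z j₀ = 1 := Subtype.ext (inv_mul_cancel₀ hy0)
  simp [h1] at hz

/-- Jacobian criterion without completeness: divide the difference of two solutions by its largest
entry. To first order the result lies in the kernel of the Jacobian over the residue field, which is
trivial by Vandermonde, yet one of its entries is `1`. -/
theorem eq_of_weightedPowerSum_eq_of_residue_eq {L : Type*} [Field L] (V : ValuationSubring L)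
    (a : J → ℕ) (ha : ∀ j, (a j : ResidueField V) ≠ 0)
    (hN : ∀ m, 1 ≤ m → m ≤ Fintype.card J → (m : ResidueField V) ≠ 0) (y y' : J → V)
    (h : ∀ m, 1 ≤ m → m ≤ Fintype.card J → weightedPowerSum a y m = weightedPowerSum a y' m)
    (hres : ∀ j, residue V (y j) = residue V (y' j))
    (hinj : Function.Injective fun j => residue V (y j)) : y = y' := by
  by_contra hne
  obtain ⟨j₁, hj₁⟩ := Function.ne_iff.mp hne
  have : Nonempty J := ⟨j₁⟩
  obtain ⟨j₀, hj₀⟩ := Finite.exists_max fun j => V.valuation (y' j - y j : L)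
  have hδ : (y' j₀ - y j₀ : L) ≠ 0 := by
    intro e
    have h1 := hj₀ j₁
    simp only [e, map_zero, le_zero_iff, map_eq_zero, sub_eq_zero] at h1
    exact hj₁ (Subtype.ext h1.symm)
  have hpos : 0 < V.valuation (y' j₀ - y j₀ : L) := by
    rw [zero_lt_iff, Ne, map_eq_zero]
    exact hδ
  let e : J → V := fun j => ⟨(y' j₀ - y j₀ : L)⁻¹ * (y' j - y j), by
    rw [← V.valuation_le_one_iff, map_mul, map_inv₀]
    exact (inv_mul_le_one₀ hpos).mpr (hj₀ j)⟩
  have he0 : e j₀ = 1 := Subtype.ext (inv_mul_cancel₀ hδ)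
  have he : ∀ j, y' j = y j + (y' j₀ - y j₀) * e j := fun j => Subtype.ext <| by
    change (y' j : L) = y j + (y' j₀ - y j₀) * ((y' j₀ - y j₀ : L)⁻¹ * (y' j - y j))
    rw [mul_inv_cancel_left₀ hδ]
    ring
  have hδ' : y' j₀ - y j₀ ≠ 0 := fun h => hδ (by simpa using congrArg (fun v : V => (v : L)) h)
  have key : ∀ m < Fintype.card J,
      ∑ j, ((a j : ResidueField V) * residue V (e j)) * residue V (y j) ^ m = 0 := by
    intro m hm
    -- Second-order Taylor expansion with increment `δ * e j`, where `δ = y' j₀ - y j₀`. One factor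
    -- `δ` cancels, and the remainder still contains another, whose residue is `0`.
    choose q hq using fun j => (Polynomial.powAddExpansion (y j) ((y' j₀ - y j₀) * e j) (m + 1)).exists_of_subtype
    have hsum : (y' j₀ - y j₀) * ∑ j, (a j : V) * (((m + 1 : ℕ) : V) * y j ^ m * e j +
        q j * (y' j₀ - y j₀) * e j ^ 2) = 0 := by
      have h1 := h (m + 1) (by omega) (by omega)
      unfold weightedPowerSum at h1
      rw [← sub_eq_zero, ← neg_eq_zero, neg_sub, ← Finset.sum_sub_distrib] at h1
      rw [← h1, Finset.mul_sum]
      refine Finset.sum_congr rfl fun j _ => ?_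
      rw [he j, hq j, Nat.add_sub_cancel]
      ring
    have h2 := congrArg (residue V) ((mul_eq_zero.mp hsum).resolve_left hδ')
    have h3 : residue V (y' j₀ - y j₀) = 0 := by rw [map_sub, hres, sub_self]
    simp only [map_sum, map_mul, map_add, h3, map_natCast, map_pow, mul_zero, zero_mul, add_zero,
      map_zero] at h2
    refine (mul_eq_zero.mp ?_).resolve_left (hN (m + 1) (by omega) (by omega))
    rw [← h2, Finset.mul_sum]
    exact Finset.sum_congr rfl fun j _ => by ring
  have := eq_zero_of_sum_mul_pow_eq_zero _ _ hinj key j₀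
  rw [he0, map_one, mul_one] at this
  exact ha j₀ this

end Valuation

/-! ### Lifting solutions from the residue field by going-down. -/

section Lifting

variable {J : Type*} [Fintype J]

open IsLocalRing

/-- Going-down needs an integrally closed base; the base will be the algebra of power sums, itself a
polynomial ring. -/
instance {R : Type*} [CommRing R] [IsDomain R] [IsIntegrallyClosed R] (n : ℕ) :
    IsIntegrallyClosed (MvPolynomial (Fin n) R) := by
  induction n with
  | zero => exact IsIntegrallyClosed.of_equiv (MvPolynomial.isEmptyAlgEquiv R (Fin 0)).symm.toRingEquiv
  | succ n ih => exact IsIntegrallyClosed.of_equiv (MvPolynomial.finSuccEquiv R n).symm.toRingEquiv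

/-- The weighted power sums of the variables of a polynomial ring, in degrees `1, …, |J|`. -/
def genericPowerSum (R : Type*) [CommRing R] (a : J → ℕ) (k : Fin (Fintype.card J)) :
    MvPolynomial J R :=
  weightedPowerSum a MvPolynomial.X (k + 1)

/-- An element outside the integral closure is avoided by some valuation ring containing that
closure. There the power sums are integral, hence so are the variables by
`mem_of_weightedPowerSum_mem`. -/
theorem isIntegral_adjoin_genericPowerSum {R : Type*} [CommRing R] [IsDomain R] (a : J → ℕ)
    (hS : ∀ S : Finset J, S.Nonempty → IsUnit ((∑ j ∈ S, a j : ℕ) : R)) :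
    Algebra.IsIntegral (Algebra.adjoin R (Set.range (genericPowerSum R a))) (MvPolynomial J R) := by
  set S₀ := Algebra.adjoin R (Set.range (genericPowerSum R a))
  have hX : ∀ j, IsIntegral S₀ (MvPolynomial.X j : MvPolynomial J R) := by
    intro j
    let L := FractionRing (MvPolynomial J R)
    rw [← isIntegral_algebraMap_iff (IsFractionRing.injective (MvPolynomial J R) L)]
    by_contra hcon
    have hnot : algebraMap (MvPolynomial J R) L (MvPolynomial.X j) ∉
        (integralClosure S₀ L).toSubring := hcon
    have : IsIntegrallyClosedIn (integralClosure S₀ L).toSubring L :=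
      inferInstanceAs (IsIntegrallyClosedIn (integralClosure S₀ L) L)
    obtain ⟨V, hV, hVX⟩ := Subring.exists_le_valuationSubring_of_isIntegrallyClosedIn hnot
    have hS₀ : ∀ s ∈ S₀, algebraMap (MvPolynomial J R) L s ∈ V := fun s hs =>
      hV (isIntegral_algebraMap (R := S₀) (x := ⟨s, hs⟩))
    refine hVX (mem_of_weightedPowerSum_mem V a (fun S hne => ?_)
      (fun j => algebraMap (MvPolynomial J R) L (MvPolynomial.X j)) (fun m h1 h2 => ?_) j)
    · let f : R →+* V := ((algebraMap (MvPolynomial J R) L).comp MvPolynomial.C).codRestrict V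
        fun r => hS₀ _ (S₀.algebraMap_mem r)
      have := ((hS S hne).map ((residue V).comp f)).ne_zero
      rwa [map_natCast] at this
    · rw [← map_weightedPowerSum]
      refine hS₀ _ (Algebra.subset_adjoin ⟨⟨m - 1, by omega⟩, ?_⟩)
      simp [genericPowerSum, Nat.sub_add_cancel h1]
  refine ⟨fun f => ?_⟩
  induction f using MvPolynomial.induction_on with
  | C r => exact isIntegral_algebraMap (R := S₀) (x := algebraMap R S₀ r)
  | add p q hp hq => exact hp.add hq
  | mul_X p j hp => exact hp.mul (hX j)

/-- The polynomial ring, of transcendence degree `|J|`, is algebraic over the algebra generated by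
these `|J|` elements, which therefore form a transcendence basis. -/
theorem algebraicIndependent_genericPowerSum {R : Type*} [CommRing R] [IsDomain R] (a : J → ℕ)
    (hS : ∀ S : Finset J, S.Nonempty → IsUnit ((∑ j ∈ S, a j : ℕ) : R)) :
    AlgebraicIndependent R (genericPowerSum R a) := by
  have := isIntegral_adjoin_genericPowerSum a hS
  have : Algebra.IsAlgebraic (Algebra.adjoin R (Set.range (genericPowerSum R a)))
    (MvPolynomial J R) := Algebra.IsIntegral.isAlgebraic
  refine (Algebra.IsAlgebraic.isTranscendenceBasis_of_lift_le_trdeg_of_finite R (genericPowerSum R a) ?_).1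
  rw [MvPolynomial.trdeg_of_isDomain]
  simp

/-- A monic polynomial over `A` splits over `A`, since `F` is algebraically closed and `A` is
integrally closed. In a domain one of the linear factors must vanish. -/
theorem exists_root_of_isIntegral {F : Type*} [Field F] [IsAlgClosed F] (A : ValuationSubring F)
    {B : Type*} [CommRing B] [IsDomain B] [Algebra A B] {b : B} (hb : IsIntegral A b) :
    ∃ r : A, b = algebraMap A B r := by
  obtain ⟨f, hf, hfb⟩ := hb
  have hsplit : (f.map (algebraMap A F)).Splits := IsAlgClosed.splits _
  have hmem : ∀ r ∈ (f.map (algebraMap A F)).roots, ∃ s : A, (s : F) = r := by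
    intro r hr
    have : IsIntegral A r := ⟨f, hf, by
      have := (mem_roots'.mp hr).2
      rwa [IsRoot, eval_map] at this⟩
    exact IsIntegrallyClosed.isIntegral_iff.mp this
  choose! g hg using hmem
  have hprod : f = ((f.map (algebraMap A F)).roots.map fun r => X - C (g r)).prod := by
    apply Polynomial.map_injective (algebraMap A F) (IsFractionRing.injective A F)
    conv_lhs => rw [hsplit.eq_prod_roots_of_monic (hf.map _)]
    rw [Polynomial.map_multiset_prod, Multiset.map_map]
    congr 1
    refine Multiset.map_congr rfl fun r hr => ?_
    have := hg r hr
    simp only [Function.comp, Polynomial.map_sub, map_X, map_C]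
    congr 2
    exact this.symm
  rw [hprod, ← coe_eval₂RingHom, map_multiset_prod, Multiset.map_map, Multiset.prod_eq_zero_iff,
    Multiset.mem_map] at hfb
  obtain ⟨r, -, hr⟩ := hfb
  refine ⟨g r, ?_⟩
  simpa [sub_eq_zero] using hr

/-- The solutions over the residue field of a system of equations prescribing the first `|J|`
weighted power sums lift to solutions over the valuation ring. -/
theorem exists_weightedPowerSum_eq_of_residue {F : Type*} [Field F] [IsAlgClosed F]
    (A : ValuationSubring F) (a : J → ℕ)
    (hS : ∀ S : Finset J, S.Nonempty → ((∑ j ∈ S, a j : ℕ) : ResidueField A) ≠ 0)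
    (y : J → ResidueField A) (c : ℕ → A)
    (h : ∀ m, 1 ≤ m → m ≤ Fintype.card J → weightedPowerSum a y m = residue A (c m)) :
    ∃ z : J → A, (∀ m, 1 ≤ m → m ≤ Fintype.card J → weightedPowerSum a z m = c m) ∧
      ∀ j, residue A (z j) = y j := by
  have hS' : ∀ S : Finset J, S.Nonempty → IsUnit ((∑ j ∈ S, a j : ℕ) : A) := fun S hne => by
    rw [← residue_ne_zero_iff_isUnit, map_natCast]
    exact hS S hne
  have hint := isIntegral_adjoin_genericPowerSum a hS'
  have hind := algebraicIndependent_genericPowerSum a hS'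
  set S₀ := Algebra.adjoin A (Set.range (genericPowerSum A a)) with hS₀
  have hclosed : IsIntegrallyClosed S₀ := IsIntegrallyClosed.of_equiv hind.aevalEquiv.toRingEquiv
  -- The power sums being independent, they can be specialized freely to the prescribed values.
  let ev : S₀ →ₐ[A] A :=
    (MvPolynomial.aeval fun k : Fin (Fintype.card J) => c (k + 1)).comp
      hind.aevalEquiv.symm.toAlgHom
  let evbar : MvPolynomial J A →ₐ[A] ResidueField A := MvPolynomial.aeval y
  have hgen : ∀ k, genericPowerSum A a k ∈ S₀ := fun k => Algebra.subset_adjoin ⟨k, rfl⟩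
  have hev : ∀ k, ev ⟨genericPowerSum A a k, hgen k⟩ = c (k + 1) := by
    intro k
    have : (⟨genericPowerSum A a k, hgen k⟩ : S₀) = hind.aevalEquiv (MvPolynomial.X k) :=
      Subtype.ext (by simp)
    simp [ev, this]
  have hcomp : (Algebra.ofId A (ResidueField A)).comp ev = evbar.comp S₀.val := by
    apply (AlgHom.cancel_right (f := hind.aevalEquiv.toAlgHom) hind.aevalEquiv.surjective).mp
    apply MvPolynomial.algHom_ext
    intro k
    have e1 : (hind.aevalEquiv (MvPolynomial.X k) : S₀) = ⟨genericPowerSum A a k, hgen k⟩ :=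
      Subtype.ext (by simp)
    change algebraMap A _ (ev (hind.aevalEquiv (MvPolynomial.X k))) =
      evbar (S₀.val (hind.aevalEquiv (MvPolynomial.X k)))
    rw [e1, hev]
    change residue A _ = evbar (genericPowerSum A a k)
    rw [genericPowerSum, map_weightedPowerSum, ← h (k + 1) (by omega) (by omega)]
    simp [evbar]
  let Q : Ideal (MvPolynomial J A) := RingHom.ker evbar
  have hQ : Q.IsPrime := RingHom.ker_isPrime _
  let P₀ : Ideal S₀ := RingHom.ker ev
  have hP₀ : P₀.IsPrime := RingHom.ker_isPrime _
  have hle : P₀ ≤ Q.under S₀ := by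
    intro s hs
    have : evbar (S₀.val s) = 0 := by
      rw [← AlgHom.comp_apply, ← hcomp, AlgHom.comp_apply, (RingHom.mem_ker).mp hs, map_zero]
    exact this
  -- Going-down: below the closed point `y` there is a prime `P` over the `A`-point `ev` of the
  -- base. Its quotient is integral over `A`, so each variable is congruent modulo `P` to an element
  -- of `A`; these elements are the lift.
  obtain ⟨P, hPQ, hP, hPP₀⟩ := Ideal.exists_ideal_le_liesOver_of_le (p := P₀) (q := Q.under S₀) Q hle
  have hmemP : ∀ s : S₀, (s : MvPolynomial J A) ∈ P ↔ ev s = 0 := fun s => by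
    have := congrArg (s ∈ ·) hPP₀.over
    simp only [eq_iff_iff] at this
    rw [← RingHom.mem_ker]
    exact this.symm
  have hconst : ∀ r : A, MvPolynomial.C r ∈ P → r = 0 := by
    intro r hr
    have := (hmemP (algebraMap A S₀ r)).mp hr
    simpa using this
  have hroot : ∀ j, ∃ r : A, MvPolynomial.X j - MvPolynomial.C r ∈ P := by
    intro j
    have hi : IsIntegral A (Ideal.Quotient.mk P (MvPolynomial.X j)) := by
      obtain ⟨f, hf, hfX⟩ := hint.isIntegral (MvPolynomial.X j)
      refine ⟨f.map ev.toRingHom, hf.map _, ?_⟩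
      rw [eval₂_map]
      have e : (algebraMap A (MvPolynomial J A ⧸ P)).comp ev.toRingHom =
          (Ideal.Quotient.mk P).comp (algebraMap S₀ (MvPolynomial J A)) := by
        ext s
        change Ideal.Quotient.mk P (MvPolynomial.C (ev s)) = Ideal.Quotient.mk P s
        rw [Ideal.Quotient.eq]
        have := (hmemP (algebraMap A S₀ (ev s) - s)).mpr (by simp)
        exact this
      rw [e, ← hom_eval₂, hfX, map_zero]
    obtain ⟨r, hr⟩ := exists_root_of_isIntegral A hi
    refine ⟨r, ?_⟩
    rw [← Ideal.Quotient.eq]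
    exact hr
  choose z hz using hroot
  refine ⟨z, fun m h1 h2 => ?_, fun j => ?_⟩
  · let k : Fin (Fintype.card J) := ⟨m - 1, by omega⟩
    have hk : (k : ℕ) + 1 = m := by simp [k, Nat.sub_add_cancel h1]
    have h3 : genericPowerSum A a k - MvPolynomial.C (c m) ∈ P := by
      have := (hmemP (⟨genericPowerSum A a k, hgen k⟩ - algebraMap A S₀ (c m))).mpr (by
        rw [map_sub, hev, hk]; simp)
      exact this
    have h4 : genericPowerSum A a k - MvPolynomial.C (weightedPowerSum a z m) ∈ P := by
      rw [← Ideal.Quotient.eq, genericPowerSum, map_weightedPowerSum, map_weightedPowerSum,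
        map_weightedPowerSum, hk]
      congr 1
      funext j
      exact Ideal.Quotient.eq.mpr (hz j)
    have h5 := P.sub_mem h3 h4
    -- The prescribed and the actual power sums differ by a constant in `P`, and `P` contains no
    -- nonzero constant.
    rw [sub_sub_sub_cancel_left, ← map_sub] at h5
    exact sub_eq_zero.mp (hconst _ h5)
  · have := hPQ (hz j)
    rw [RingHom.mem_ker, map_sub, sub_eq_zero] at this
    simpa [evbar] using this.symm

end Lifting

/-! ### The polynomial `∏ (1 - y_j X) ^ a_j` and its derivative. -/

section TreePolynomial

variable {J : Type*} [Fintype J]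

/-- The polynomial `∏ (1 - y_j X) ^ a_j`. -/
def treePoly {R : Type*} [CommRing R] (a : J → ℕ) (y : J → R) : R[X] :=
  ∏ j, (1 - C (y j) * X) ^ a j

theorem map_treePoly {R S : Type*} [CommRing R] [CommRing S] (f : R →+* S) (a : J → ℕ) (y : J → R) :
    (treePoly a y).map f = treePoly a fun j => f (y j) := by
  simp [treePoly, Polynomial.map_prod]

theorem treePoly_comp_C_mul_X {R : Type*} [CommRing R] (a : J → ℕ) (y : J → R) (u : R) :
    (treePoly a y).comp (C u * X) = treePoly a fun j => u * y j := by
  simp only [treePoly, Polynomial.prod_comp, pow_comp, sub_comp, one_comp, mul_comp, C_comp, X_comp]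
  refine Finset.prod_congr rfl fun j _ => ?_
  rw [C_mul]
  ring

theorem treePoly_comp_perm {R : Type*} [CommRing R] (a : J → ℕ) (y : J → R) (π : Equiv.Perm J)
    (hπ : ∀ j, a (π j) = a j) : treePoly a (y ∘ π) = treePoly a y := by
  unfold treePoly
  rw [← Equiv.prod_comp π fun j => (1 - C (y j) * X) ^ a j]
  simp [hπ]

theorem eval_zero_treePoly {R : Type*} [CommRing R] (a : J → ℕ) (y : J → R) :
    (treePoly a y).eval 0 = 1 := by
  simp [treePoly, eval_prod]

theorem eval_treePoly_eq_zero_iff {R : Type*} [CommRing R] [IsDomain R] (a : J → ℕ)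
    (ha : ∀ j, a j ≠ 0) (y : J → R) (t : R) : (treePoly a y).eval t = 0 ↔ ∃ j, y j * t = 1 := by
  simp only [treePoly, eval_prod, Finset.prod_eq_zero_iff, Finset.mem_univ, true_and, eval_pow,
    pow_eq_zero_iff (ha _), eval_sub, eval_one, eval_mul, eval_C, eval_X, sub_eq_zero]
  simp only [eq_comm]

theorem one_sub_C_mul_X_mul_mk {R : Type*} [CommRing R] (y : R) :
    (1 - PowerSeries.C y * PowerSeries.X) * PowerSeries.mk (fun m => y ^ m) = 1 := by
  ext m
  rw [sub_mul, one_mul, map_sub, mul_assoc, PowerSeries.coeff_C_mul, PowerSeries.coeff_mk,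
    PowerSeries.coeff_one]
  cases m with
  | zero => simp
  | succ m => rw [PowerSeries.coeff_succ_X_mul, PowerSeries.coeff_mk]; simp [pow_succ']

theorem mk_weightedPowerSum {R : Type*} [CommRing R] (a : J → ℕ) (y : J → R) :
    PowerSeries.mk (fun m => weightedPowerSum a y (m + 1)) =
      ∑ j, PowerSeries.C ((a j : R) * y j) * PowerSeries.mk (fun m => y j ^ m) := by
  ext m
  simp only [PowerSeries.coeff_mk, weightedPowerSum, map_sum, PowerSeries.coeff_C_mul]
  exact Finset.sum_congr rfl fun j _ => by ring

/-- The logarithmic derivative of `∏ (1 - y_j X) ^ a_j` is minus the generating series of the weighted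
power sums. -/
theorem coe_derivative_treePoly {R : Type*} [CommRing R] (a : J → ℕ) (y : J → R) :
    ((derivative (treePoly a y) : R[X]) : PowerSeries R) =
      -((treePoly a y : R[X]) : PowerSeries R) *
        PowerSeries.mk fun m => weightedPowerSum a y (m + 1) := by
  classical
  rw [← PowerSeries.derivative_coe, mk_weightedPowerSum]
  have hcoe : ((treePoly a y : R[X]) : PowerSeries R) =
      ∏ j, (1 - PowerSeries.C (y j) * PowerSeries.X) ^ a j := by
    rw [treePoly, ← Polynomial.coeToPowerSeries.ringHom_apply, map_prod]
    simp
  rw [hcoe]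
  have hfactor : ∀ j, PowerSeries.derivative R ((1 - PowerSeries.C (y j) * PowerSeries.X) ^ a j) =
      -(1 - PowerSeries.C (y j) * PowerSeries.X) ^ a j *
        (PowerSeries.C ((a j : R) * y j) * PowerSeries.mk (fun m => y j ^ m)) := by
    intro j
    have hd : PowerSeries.derivative R (1 - PowerSeries.C (y j) * PowerSeries.X) =
        -PowerSeries.C (y j) := by
      have h1 : PowerSeries.derivative R (1 : PowerSeries R) = 0 := PowerSeries.derivative_one
      rw [map_sub, h1, Derivation.leibniz]
      simp
    rw [PowerSeries.derivative_pow, hd]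
    cases a j with
    | zero => simp
    | succ b =>
      rw [Nat.add_sub_cancel, pow_succ, map_mul, map_natCast]
      linear_combination (-(((b + 1 : ℕ) : PowerSeries R)) * PowerSeries.C (y j) *
        (1 - PowerSeries.C (y j) * PowerSeries.X) ^ b) * -(one_sub_C_mul_X_mul_mk (y j))
  suffices ∀ s : Finset J,
      PowerSeries.derivative R (∏ j ∈ s, (1 - PowerSeries.C (y j) * PowerSeries.X) ^ a j) =
      -(∏ j ∈ s, (1 - PowerSeries.C (y j) * PowerSeries.X) ^ a j) *
        ∑ j ∈ s, PowerSeries.C ((a j : R) * y j) * PowerSeries.mk (fun m => y j ^ m) from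
    this Finset.univ
  intro s
  induction s using Finset.induction_on with
  | empty => simp
  | insert j s hj ih =>
    rw [Finset.prod_insert hj, Finset.sum_insert hj, Derivation.leibniz, ih, hfactor, smul_eq_mul,
      smul_eq_mul]
    ring

/-- The polynomial has constant term `1`, so it is a unit among power series and does not affect
divisibility by `X ^ d`. -/
theorem X_pow_dvd_derivative_treePoly_iff {k : Type*} [Field k] (a : J → ℕ) (y : J → k) (d : ℕ) :
    X ^ d ∣ derivative (treePoly a y) ↔ ∀ m, 1 ≤ m → m ≤ d → weightedPowerSum a y m = 0 := by
  have hunit : IsUnit (-((treePoly a y : k[X]) : PowerSeries k)) := by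
    refine IsUnit.neg (PowerSeries.isUnit_iff_constantCoeff.mpr ?_)
    rw [Polynomial.constantCoeff_coe, coeff_zero_eq_eval_zero, eval_zero_treePoly]
    exact isUnit_one
  have h1 : X ^ d ∣ derivative (treePoly a y) ↔
      PowerSeries.X ^ d ∣ ((derivative (treePoly a y) : k[X]) : PowerSeries k) := by
    simp [Polynomial.X_pow_dvd_iff, PowerSeries.X_pow_dvd_iff]
  rw [h1, coe_derivative_treePoly, hunit.dvd_mul_left, PowerSeries.X_pow_dvd_iff]
  simp only [PowerSeries.coeff_mk]
  constructor
  · intro h m hm1 hm2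
    have := h (m - 1) (by omega)
    rwa [Nat.sub_add_cancel hm1] at this
  · intro h m hm
    exact h (m + 1) (by omega) (by omega)

theorem mk_weightedPowerSum_eq_X_pow_mul {R : Type*} [CommRing R] (a : J → ℕ) (y : J → R)
    {N : ℕ} (h : ∀ m, 1 ≤ m → m ≤ N → weightedPowerSum a y m = 0) :
    PowerSeries.mk (fun m => weightedPowerSum a y (m + 1)) =
      PowerSeries.X ^ N * PowerSeries.mk fun m => weightedPowerSum a y (m + N + 1) := by
  ext m
  rw [PowerSeries.coeff_mk, PowerSeries.coeff_X_pow_mul']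
  split_ifs with hm
  · rw [PowerSeries.coeff_mk, Nat.sub_add_cancel hm]
  · exact h (m + 1) (by omega) (by omega)

/-- The numerator of `∑ a_j y_j / (1 - y_j X)` has degree less than `|J|`, and the equations make it
divisible by `X ^ (|J| - 1)`; so it is a monomial. Consequently the only critical points are `0` and
zeros of the polynomial. -/
theorem derivative_treePoly_mul_prod {R : Type*} [CommRing R] (a : J → ℕ) (y : J → R)
    (hJ : 0 < Fintype.card J)
    (h : ∀ m, 1 ≤ m → m < Fintype.card J → weightedPowerSum a y m = 0) :
    derivative (treePoly a y) * ∏ j, (1 - C (y j) * X) =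
      -(C (weightedPowerSum a y (Fintype.card J)) * X ^ (Fintype.card J - 1) * treePoly a y) := by
  classical
  obtain ⟨N, hN⟩ : ∃ N, Fintype.card J = N + 1 := ⟨_, (Nat.succ_pred_eq_of_pos hJ).symm⟩
  rw [hN] at h ⊢
  rw [Nat.add_sub_cancel]
  let Q : R[X] := ∑ j, C ((a j : R) * y j) * ∏ l ∈ Finset.univ.erase j, (1 - C (y l) * X)
  have hP : ((∏ j, (1 - C (y j) * X) : R[X]) : PowerSeries R) =
      ∏ j, (1 - PowerSeries.C (y j) * PowerSeries.X) := by
    rw [← Polynomial.coeToPowerSeries.ringHom_apply, map_prod]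
    simp
  have hQ : (Q : PowerSeries R) = PowerSeries.mk (fun m => weightedPowerSum a y (m + 1)) *
      ((∏ j, (1 - C (y j) * X) : R[X]) : PowerSeries R) := by
    rw [hP, mk_weightedPowerSum, Finset.sum_mul, ← Polynomial.coeToPowerSeries.ringHom_apply, map_sum]
    refine Finset.sum_congr rfl fun j _ => ?_
    rw [← Finset.mul_prod_erase _ _ (Finset.mem_univ j), map_mul, map_prod]
    simp only [Polynomial.coeToPowerSeries.ringHom_apply, Polynomial.coe_C, Polynomial.coe_sub,
      Polynomial.coe_one, Polynomial.coe_mul, Polynomial.coe_X]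
    linear_combination (-PowerSeries.C ((a j : R) * y j) *
      ∏ l ∈ Finset.univ.erase j, (1 - PowerSeries.C (y l) * PowerSeries.X)) *
        one_sub_C_mul_X_mul_mk (y j)
  have hdeg : Q.natDegree ≤ N := by
    refine natDegree_sum_le_of_forall_le _ _ fun j _ => (natDegree_C_mul_le _ _).trans ?_
    refine (natDegree_prod_le _ _).trans ?_
    refine (Finset.sum_le_card_nsmul _ _ 1 fun l _ => ?_).trans ?_
    · refine (natDegree_sub_le _ _).trans ?_
      simpa using (natDegree_C_mul_le _ _).trans natDegree_X_le
    · rw [Finset.card_erase_of_mem (Finset.mem_univ _), Finset.card_univ, hN]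
      simp
  have hQ' : Q = C (weightedPowerSum a y (N + 1)) * X ^ N := by
    rw [mk_weightedPowerSum_eq_X_pow_mul (N := N) a y fun m h1 h2 => h m h1 (by omega), mul_assoc] at hQ
    ext m
    rw [coeff_C_mul_X_pow]
    split_ifs with hm
    · subst hm
      have := congrArg (PowerSeries.coeff m) hQ
      rw [PowerSeries.coeff_X_pow_mul', if_pos le_rfl, Nat.sub_self, Polynomial.coeff_coe] at this
      rw [this, PowerSeries.coeff_zero_eq_constantCoeff_apply, map_mul, hP, map_prod,
        Finset.prod_eq_one fun j _ => by simp, mul_one,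
        ← PowerSeries.coeff_zero_eq_constantCoeff_apply, PowerSeries.coeff_mk, zero_add]
    · rcases lt_or_gt_of_ne hm with hm | hm
      · have := congrArg (PowerSeries.coeff m) hQ
        rwa [PowerSeries.coeff_X_pow_mul', if_neg (by omega), Polynomial.coeff_coe] at this
      · exact coeff_eq_zero_of_natDegree_lt (by omega)
  apply Polynomial.coe_injective
  rw [← hQ', Polynomial.coe_mul, coe_derivative_treePoly, Polynomial.coe_neg, Polynomial.coe_mul, hQ]
  ring

end TreePolynomial

/-! ### Standard models as solutions of the power sum equations. -/

section StandardModels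

variable {J : Type*} [Fintype J] {F : Type*} [Field F]

theorem treePoly_eq_C_mul_prod (a : J → ℕ) (y : J → F) (hy : ∀ j, y j ≠ 0) :
    treePoly a y = C (∏ j, (-y j) ^ a j) * ∏ j, (X - C (y j)⁻¹) ^ a j := by
  rw [map_prod, ← Finset.prod_mul_distrib]
  refine Finset.prod_congr rfl fun j _ => ?_
  rw [C_pow, ← mul_pow, mul_sub, ← C_mul, neg_mul, mul_inv_cancel₀ (hy j)]
  simp only [map_neg, map_one]
  ring

theorem treePoly_ne_zero (a : J → ℕ) (y : J → F) : treePoly a y ≠ 0 := fun h => by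
  simpa [h] using eval_zero_treePoly a y

theorem roots_treePoly (a : J → ℕ) (y : J → F) (hy : ∀ j, y j ≠ 0) :
    (treePoly a y).roots = ∑ j, a j • {(y j)⁻¹} := by
  rw [treePoly_eq_C_mul_prod a y hy, roots_C_mul, roots_prod]
  · simp only [roots_pow, roots_X_sub_C]
    rfl
  · exact Finset.prod_ne_zero_iff.mpr fun j _ => pow_ne_zero _ (X_sub_C_ne_zero _)
  · exact Finset.prod_ne_zero_iff.mpr fun j _ => pow_ne_zero _ (neg_ne_zero.mpr (hy j))

theorem rootMultiplicity_treePoly (a : J → ℕ) (y : J → F) (hy : ∀ j, y j ≠ 0)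
    (hinj : Function.Injective y) (j : J) : (treePoly a y).rootMultiplicity (y j)⁻¹ = a j := by
  classical
  rw [← count_roots, roots_treePoly a y hy, Multiset.count_sum']
  simp [Multiset.count_singleton, hinj.eq_iff]

theorem natDegree_treePoly (a : J → ℕ) (y : J → F) (hy : ∀ j, y j ≠ 0) :
    (treePoly a y).natDegree = ∑ j, a j := by
  rw [treePoly_eq_C_mul_prod a y hy, natDegree_C_mul
    (Finset.prod_ne_zero_iff.mpr fun j _ => pow_ne_zero _ (neg_ne_zero.mpr (hy j))),
    natDegree_prod_of_monic _ _ fun j _ => (monic_X_sub_C _).pow _]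
  simp

theorem inversePowerSum_treePoly (a : J → ℕ) (y : J → F) (hy : ∀ j, y j ≠ 0) (m : ℕ) :
    inversePowerSum m (treePoly a y) = weightedPowerSum a y m := by
  rw [inversePowerSum, roots_treePoly a y hy, weightedPowerSum]
  have := map_sum (Multiset.sumAddMonoidHom.comp (Multiset.mapAddMonoidHom fun r : F => r⁻¹ ^ m))
    (fun j => a j • ({(y j)⁻¹} : Multiset F)) Finset.univ
  simp only [AddMonoidHom.coe_comp, Function.comp, Multiset.coe_mapAddMonoidHom,
    Multiset.coe_sumAddMonoidHom] at this
  rw [this]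
  refine Finset.sum_congr rfl fun j _ => ?_
  rw [Multiset.map_nsmul, Multiset.sum_nsmul]
  simp

/-- One more vanishing power sum would contradict Vandermonde for the weights `a j * y j`. This
makes the ramification index at `0` exactly `|J|`, and allows rescaling to a Kummer model. -/
theorem weightedPowerSum_card_ne_zero (a : J → ℕ) (ha : ∀ j, (a j : F) ≠ 0) (y : J → F)
    (hy : ∀ j, y j ≠ 0) (hinj : Function.Injective y) [Nonempty J]
    (h : ∀ m, 1 ≤ m → m < Fintype.card J → weightedPowerSum a y m = 0) :
    weightedPowerSum a y (Fintype.card J) ≠ 0 := by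
  intro h0
  obtain ⟨j⟩ := ‹Nonempty J›
  have := eq_zero_of_sum_mul_pow_eq_zero (fun j => (a j : F) * y j) y hinj (fun m hm => by
    have h1 : weightedPowerSum a y (m + 1) = 0 := by
      rcases Nat.lt_or_ge (m + 1) (Fintype.card J) with h2 | h2
      · exact h (m + 1) (by omega) h2
      · rwa [show m + 1 = Fintype.card J by omega]
    rw [← h1]
    exact Finset.sum_congr rfl fun j _ => by ring) j
  exact mul_ne_zero (ha j) (hy j) this

/-- A polynomial `∏ (1 - y_j X) ^ a_j` whose `y_j` are distinct, nonzero and annihilate the first `n - 1`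
weighted power sums is a standard model. -/
theorem isStandardModel_treePoly (a : J → ℕ) [Nonempty J] (ha : ∀ j, (a j : F) ≠ 0)
    (hsum : ((∑ j, a j : ℕ) : F) ≠ 0) (hN : ∀ m, 1 ≤ m → m ≤ Fintype.card J → (m : F) ≠ 0)
    (y : J → F) (hy : ∀ j, y j ≠ 0) (hinj : Function.Injective y)
    (h : ∀ m, 1 ≤ m → m < Fintype.card J → weightedPowerSum a y m = 0) :
    IsStandardModel a (treePoly a y) := by
  have hcard : 0 < Fintype.card J := Fintype.card_pos
  have ha' : ∀ j, a j ≠ 0 := fun j e => ha j (by simp [e])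
  have hφ := weightedPowerSum_card_ne_zero a ha y hy hinj h
  have hder : ∀ t, t ≠ 0 → (derivative (treePoly a y)).eval t = 0 → (treePoly a y).eval t = 0 := by
    intro t ht h0
    have := congrArg (eval t) (derivative_treePoly_mul_prod a y hcard h)
    rw [eval_mul, h0, zero_mul, eval_neg, eval_mul, eval_mul, eval_C, eval_pow, eval_X, eq_comm,
      neg_eq_zero] at this
    exact (mul_eq_zero.mp this).resolve_left (mul_ne_zero hφ (pow_ne_zero _ ht))
  -- In degrees below `|J|` the derivative is a single monomial. Integrating it term by term uses
  -- that `1, …, |J|` are invertible in `F`.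
  have hcoeff : ∀ m, m < Fintype.card J → (derivative (treePoly a y)).coeff m =
      if m = Fintype.card J - 1 then -weightedPowerSum a y (Fintype.card J) else 0 := by
    intro m hm
    rw [← Polynomial.coeff_coe, coe_derivative_treePoly, mk_weightedPowerSum_eq_X_pow_mul
      (N := Fintype.card J - 1) a y fun m h1 h2 => h m h1 (by omega), mul_left_comm,
      PowerSeries.coeff_X_pow_mul']
    split_ifs with h1 h2 h2
    · subst h2
      rw [Nat.sub_self, PowerSeries.coeff_zero_eq_constantCoeff_apply, map_mul, map_neg,
        Polynomial.constantCoeff_coe, coeff_zero_eq_eval_zero, eval_zero_treePoly,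
        ← PowerSeries.coeff_zero_eq_constantCoeff_apply, PowerSeries.coeff_mk, neg_one_mul]
      congr 2
      omega
    · omega
    · omega
    · rfl
  have hne : treePoly a y - 1 ≠ 0 := by
    intro h0
    rw [sub_eq_zero] at h0
    have := hcoeff (Fintype.card J - 1) (by omega)
    rw [h0, if_pos rfl] at this
    simp [eq_comm, hφ] at this
  have hcoeff' : ∀ m, m < Fintype.card J → (treePoly a y - 1).coeff m = 0 := by
    intro m hm
    cases m with
    | zero => rw [coeff_zero_eq_eval_zero, eval_sub, eval_zero_treePoly, eval_one, sub_self]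
    | succ m =>
      have h1 := hcoeff m (by omega)
      rw [coeff_derivative, if_neg (by omega)] at h1
      rw [coeff_sub, coeff_one, if_neg (by omega), sub_zero]
      refine (mul_eq_zero.mp h1).resolve_right ?_
      exact_mod_cast hN (m + 1) (by omega) (by omega)
  refine ⟨fun t h0 => ?_, ⟨fun j => (y j)⁻¹, fun i j hij => hinj (inv_injective hij), fun t => ?_,
    rootMultiplicity_treePoly a y hy hinj⟩, ⟨eval_zero_treePoly a y, ?_⟩, fun t ht h1 => ?_, ha,
    hN _ hcard le_rfl, by rwa [natDegree_treePoly a y hy]⟩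
  · by_cases ht : t = 0
    · subst ht
      exact Or.inr (eval_zero_treePoly a y)
    · exact Or.inl (hder t ht h0)
  · rw [eval_treePoly_eq_zero_iff a ha', Set.mem_range]
    exact exists_congr fun j => mul_eq_one_iff_inv_eq₀ (hy j)
  · refine le_antisymm (not_lt.mp fun hlt => ?_) ?_
    · rw [Nat.lt_iff_add_one_le, le_rootMultiplicity_iff hne, C_0, sub_zero,
        Polynomial.X_pow_dvd_iff] at hlt
      have h1 := hlt (Fintype.card J) (by omega)
      have h2 := hcoeff (Fintype.card J - 1) (by omega)
      rw [coeff_derivative, if_pos rfl, Nat.sub_add_cancel hcard] at h2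
      rw [coeff_sub, coeff_one, if_neg (by omega), sub_zero] at h1
      rw [h1, zero_mul, eq_comm, neg_eq_zero] at h2
      exact hφ h2
    · rw [le_rootMultiplicity_iff hne, C_0, sub_zero, Polynomial.X_pow_dvd_iff]
      exact hcoeff'
  · have hroot : (treePoly a y - 1).IsRoot t := by simp [IsRoot, h1]
    refine le_antisymm (not_lt.mp fun hlt => ?_) ((rootMultiplicity_pos hne).mpr hroot)
    have := ((one_lt_rootMultiplicity_iff_isRoot hne).mp hlt).2
    rw [IsRoot, derivative_sub, derivative_one, sub_zero] at this
    have := hder t ht this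
    rw [h1] at this
    exact one_ne_zero this

/-- The `y j` are the inverses of the points above `0`; the value `1` at the origin fixes the
leading coefficient. -/
theorem exists_eq_treePoly_of_isStandardModel [IsAlgClosed F] (a : J → ℕ) (β : F[X])
    (hβ : IsStandardModel a β) : ∃ y : J → F, Function.Injective y ∧ (∀ j, y j ≠ 0) ∧
      (∀ m, 1 ≤ m → m < Fintype.card J → weightedPowerSum a y m = 0) ∧ β = treePoly a y := by
  classical
  obtain ⟨r, hinj, hr, hmult⟩ := hβ.fibre_zero
  have h0 : β.eval 0 = 1 := hβ.index_one.1
  have hβ0 : β ≠ 0 := fun h => by simp [h] at h0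
  have hr0 : ∀ j, r j ≠ 0 := fun j h => by
    have := (hr (r j)).mpr ⟨j, rfl⟩
    rw [h, h0] at this
    exact one_ne_zero this
  have hroots : β.roots = ∑ j, a j • {r j} := by
    ext t
    rw [Multiset.count_sum', count_roots]
    by_cases ht : t ∈ Set.range r
    · obtain ⟨j, rfl⟩ := ht
      rw [hmult]
      simp [Multiset.count_singleton, hinj.eq_iff]
    · rw [rootMultiplicity_eq_zero fun h => ht ((hr t).mp h), Finset.sum_eq_zero]
      intro j _
      rw [Multiset.count_nsmul, Multiset.count_singleton, if_neg (fun h => ht ⟨j, h.symm⟩), mul_zero]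
  have hy0 : ∀ j, (r j)⁻¹ ≠ 0 := fun j => inv_ne_zero (hr0 j)
  have heq : β = treePoly a fun j => (r j)⁻¹ := by
    have h1 := (IsAlgClosed.splits β).eq_prod_roots
    have h2 := (IsAlgClosed.splits (treePoly a fun j => (r j)⁻¹)).eq_prod_roots
    rw [roots_treePoly a _ hy0] at h2
    simp only [inv_inv] at h2
    rw [hroots] at h1
    set q := (Multiset.map (fun a => X - C a) (∑ j, a j • {r j})).prod
    have e1 := congrArg (eval 0) h1
    have e2 := congrArg (eval 0) h2
    rw [h0, eval_mul, eval_C] at e1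
    rw [eval_zero_treePoly, eval_mul, eval_C, e1] at e2
    have hq : q.eval 0 ≠ 0 := fun h => by simp [h] at e1
    rw [h1, h2, mul_right_cancel₀ hq e2]
  refine ⟨fun j => (r j)⁻¹, fun i j h => hinj (inv_injective h), hy0, ?_, heq⟩
  intro m hm1 hm2
  have hdvd : X ^ (Fintype.card J - 1) ∣ derivative β := by
    rw [Polynomial.X_pow_dvd_iff]
    intro d hd
    -- The multiplicity criterion requires `β - 1` to be nonzero; a constant `β` has zero derivative
    -- anyway.
    by_cases hne : β - 1 = 0
    · rw [sub_eq_zero.mp hne]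
      simp
    · have := (le_rootMultiplicity_iff hne).mp hβ.index_one.2.ge
      rw [C_0, sub_zero, Polynomial.X_pow_dvd_iff] at this
      have := this (d + 1) (by omega)
      rw [coeff_sub, coeff_one, if_neg (by omega), sub_zero] at this
      rw [coeff_derivative, this, zero_mul]
  rw [heq, X_pow_dvd_derivative_treePoly_iff] at hdvd
  exact hdvd m hm1 (by omega)

/-- The zeros determine the coordinates up to a permutation, and their multiplicities force it to
preserve the weights. -/
theorem exists_perm_of_treePoly_eq (a : J → ℕ) (ha : ∀ j, a j ≠ 0) (y z : J → F)
    (hy : ∀ j, y j ≠ 0) (hyinj : Function.Injective y) (hz : ∀ j, z j ≠ 0)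
    (hzinj : Function.Injective z) (h : treePoly a y = treePoly a z) :
    ∃ π : Equiv.Perm J, (∀ j, a (π j) = a j) ∧ z = y ∘ π := by
  have h1 : ∀ j, ∃ l, y l = z j := fun j => by
    have h2 : (treePoly a z).eval (z j)⁻¹ = 0 :=
      (eval_treePoly_eq_zero_iff a ha z _).mpr ⟨j, mul_inv_cancel₀ (hz j)⟩
    rw [← h] at h2
    obtain ⟨l, hl⟩ := (eval_treePoly_eq_zero_iff a ha y _).mp h2
    exact ⟨l, (mul_inv_eq_one₀ (hz j)).mp hl⟩
  choose f hf using h1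
  have hfinj : Function.Injective f := fun i j e => hzinj (by rw [← hf, ← hf, e])
  refine ⟨Equiv.ofBijective f (Finite.injective_iff_bijective.mp hfinj), fun j => ?_, ?_⟩
  · rw [Equiv.ofBijective_apply, ← rootMultiplicity_treePoly a y hy hyinj, hf, h,
      rootMultiplicity_treePoly a z hz hzinj]
  · funext j
    simp [hf]

theorem exists_treePoly_of_map_eq [IsAlgClosed F] {L : Type*} [Field L] (ι : F →+* L) (a : J → ℕ)
    (ha : ∀ j, a j ≠ 0) (y : J → L) (hy : ∀ j, y j ≠ 0) (f : F[X]) (hf : f.map ι = treePoly a y) :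
    ∃ z : J → F, (∀ j, ι (z j) = y j) ∧ f = treePoly a z := by
  have hroots : (f.map ι).roots = f.roots.map ι := (IsAlgClosed.splits f).roots_map ι
  have h1 : ∀ j, ∃ r, ι r = (y j)⁻¹ := fun j => by
    have : (y j)⁻¹ ∈ (f.map ι).roots := by
      rw [hf, mem_roots (treePoly_ne_zero a y)]
      exact (eval_treePoly_eq_zero_iff a ha y _).mpr ⟨j, mul_inv_cancel₀ (hy j)⟩
    rw [hroots, Multiset.mem_map] at this
    obtain ⟨r, -, hr⟩ := this
    exact ⟨r, hr⟩
  choose r hr using h1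
  have hz : ∀ j, ι (r j)⁻¹ = y j := fun j => by rw [map_inv₀, hr, inv_inv]
  refine ⟨fun j => (r j)⁻¹, hz, Polynomial.map_injective ι ι.injective ?_⟩
  rw [hf, map_treePoly]
  simp only [hz]

end StandardModels

/-! ### Homothetic models fixed by Galois conjugation. -/

section Descent

theorem exists_sum_mul_eq_generator (s : Finset ℕ) :
    ∃ (d : ℕ) (n : ℕ → ℤ), ∑ k ∈ s, n k * (k : ℤ) = d ∧ ∀ k ∈ s, d ∣ k := by
  obtain ⟨g, hg⟩ := (IsPrincipalIdealRing.principal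
    (Ideal.span ((fun k : ℕ => (k : ℤ)) '' (s : Set ℕ)))).principal
  have hmem : (g.natAbs : ℤ) ∈ Ideal.span ((fun k : ℕ => (k : ℤ)) '' (s : Set ℕ)) := by
    rw [hg, Int.natCast_natAbs]
    exact Ideal.mem_span_singleton.mpr (self_dvd_abs g)
  obtain ⟨n, hn⟩ := (Submodule.mem_span_image_finset_iff_exists_fun' ℤ).mp hmem
  refine ⟨g.natAbs, n, by simpa using hn, fun k hk => ?_⟩
  have : (k : ℤ) ∈ Ideal.span ((fun k : ℕ => (k : ℤ)) '' (s : Set ℕ)) :=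
    Ideal.subset_span ⟨k, hk, rfl⟩
  rw [hg] at this
  exact Int.natAbs_dvd_natAbs.mpr (Ideal.mem_span_singleton.mp this)

/-- Up to a homothety, a polynomial is fixed by all the automorphisms which transform it
by a homothety. -/
theorem exists_comp_forall_map_eq {F : Type*} [Field F] [IsAlgClosed F] (f : F[X]) :
    ∃ u : F, u ≠ 0 ∧ ∀ (σ : F →+* F) (v : F), v ≠ 0 →
      (f.comp (C u * X)).map σ = (f.comp (C u * X)).comp (C v * X) →
        (f.comp (C u * X)).map σ = f.comp (C u * X) := by
  obtain ⟨d, n, hd, hdvd⟩ := exists_sum_mul_eq_generator f.support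
  have hcoeff : ∀ (g : F[X]) (σ : F →+* F) (v : F), g.map σ = g.comp (C v * X) →
      ∀ k, σ (g.coeff k) = g.coeff k * v ^ k := fun g σ v h k => by
    rw [← coeff_map, h, comp_C_mul_X_coeff]
  have hroot : ∀ (g : F[X]) (σ : F →+* F) (v : F), g.map σ = g.comp (C v * X) →
      (∀ k ∈ g.support, v ^ k = 1) → g.map σ = g := fun g σ v h hv => by
    ext k
    rw [coeff_map, hcoeff g σ v h]
    by_cases hk : k ∈ g.support
    · rw [hv k hk, mul_one]
    · rw [notMem_support_iff.mp hk, zero_mul]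
  rcases Nat.eq_zero_or_pos d with rfl | hdpos
  · refine ⟨1, one_ne_zero, fun σ v _ h => hroot _ σ v h fun k hk => ?_⟩
    rw [C_1, one_mul, comp_X] at hk
    rw [Nat.eq_zero_of_zero_dvd (hdvd k hk), pow_zero]
  -- By Bézout, this monomial in the coefficients is multiplied by `u ^ d` under `X ↦ u X`, where
  -- `d` is a gcd of the exponents. Choosing `u` to make it `1` forces `v ^ d = 1` for every
  -- homothety `v` realized by some `σ`.
  · set c : F := ∏ k ∈ f.support, f.coeff k ^ n k with hc
    have hc0 : c ≠ 0 := Finset.prod_ne_zero_iff.mpr fun k hk => zpow_ne_zero _ (mem_support_iff.mp hk)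
    obtain ⟨u, hu⟩ := IsAlgClosed.exists_pow_nat_eq c⁻¹ hdpos
    have hu0 : u ≠ 0 := fun h => by
      rw [h, zero_pow hdpos.ne'] at hu
      exact inv_ne_zero hc0 hu.symm
    have hpow : ∀ v : F, v ≠ 0 → ∏ k ∈ f.support, (v ^ k) ^ n k = v ^ d := fun v hv => by
      rw [← zpow_natCast v d, ← hd]
      have h1 : ∀ s : Finset ℕ, ∏ k ∈ s, (v ^ k) ^ n k = v ^ ∑ k ∈ s, n k * (k : ℤ) := fun s => by
        induction s using Finset.induction_on with
        | empty => simp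
        | insert k s hk ih =>
          rw [Finset.prod_insert hk, Finset.sum_insert hk, zpow_add₀ hv, ih, mul_comm (n k),
            zpow_mul, zpow_natCast]
      exact h1 _
    refine ⟨u, hu0, fun σ v hv h => hroot _ σ v h fun k hk => ?_⟩
    have hprod : ∏ k ∈ f.support, ((f.comp (C u * X)).coeff k) ^ n k = 1 := by
      simp only [comp_C_mul_X_coeff, mul_zpow]
      rw [Finset.prod_mul_distrib, hpow u hu0, hu, ← hc, mul_inv_cancel₀ hc0]
    have hvd : v ^ d = 1 := by
      rw [← hpow v hv]
      have h2 := congrArg σ hprod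
      rw [map_one, map_prod] at h2
      simp only [map_zpow₀, hcoeff _ σ v h, mul_zpow] at h2
      rwa [Finset.prod_mul_distrib, hprod, one_mul] at h2
    have hk' : k ∈ f.support := by
      rw [mem_support_iff, comp_C_mul_X_coeff] at hk
      exact mem_support_iff.mpr (left_ne_zero_of_mul hk)
    obtain ⟨e, rfl⟩ := hdvd k hk'
    rw [pow_mul, hvd, one_pow]

end Descent

/-! ### Kummer models have coefficients in the Kummer field. -/

section KummerField

variable {J : Type*} [Fintype J]

theorem sum_cast_ne_zero {J F : Type*} [Field F] [CharZero F] (a : J → ℕ) (ha : ∀ j, 0 < a j)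
    (S : Finset J) (hS : S.Nonempty) : ((∑ j ∈ S, a j : ℕ) : F) ≠ 0 :=
  Nat.cast_ne_zero.mpr (Finset.sum_pos (fun j _ => ha j) hS).ne'

theorem isStandardModel_treePoly_of_charZero {F : Type*} [Field F] [CharZero F] (a : J → ℕ)
    (ha : ∀ j, 0 < a j) [Nonempty J] (y : J → F) (hy : ∀ j, y j ≠ 0)
    (hinj : Function.Injective y)
    (h : ∀ m, 1 ≤ m → m < Fintype.card J → weightedPowerSum a y m = 0) :
    IsStandardModel a (treePoly a y) :=
  isStandardModel_treePoly a (fun j => Nat.cast_ne_zero.mpr (ha j).ne')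
    (sum_cast_ne_zero a ha _ Finset.univ_nonempty) (fun m hm _ => Nat.cast_ne_zero.mpr (by omega))
    y hy hinj h

theorem exists_eq_treePoly_of_isKummerModel {F : Type*} [Field F] [IsAlgClosed F] (a : J → ℕ)
    (γ : F[X]) (hγ : IsKummerModel a γ) : ∃ y : J → F, Function.Injective y ∧ (∀ j, y j ≠ 0) ∧
      (∀ m, 1 ≤ m → m < Fintype.card J → weightedPowerSum a y m = 0) ∧
      weightedPowerSum a y (Fintype.card J) = 1 ∧ γ = treePoly a y := by
  obtain ⟨y, hinj, hy, hφ, rfl⟩ := exists_eq_treePoly_of_isStandardModel a γ hγ.1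
  exact ⟨y, hinj, hy, hφ, by rw [← inversePowerSum_treePoly a y hy, hγ.2], rfl⟩

theorem mem_fieldOfModuli (β : Qbar[X]) (z : Qbar)
    (h : ∀ σ : Qbar ≃ₐ[ℚ] Qbar, SameTree β (β.map (σ : Qbar →+* Qbar)) → σ z = z) :
    z ∈ fieldOfModuli β := by
  rw [fieldOfModuli, IntermediateField.mem_fixedField_iff]
  intro σ hσ
  induction hσ using Subgroup.closure_induction with
  | mem σ hσ => exact h σ hσ
  | one => rfl
  | mul σ τ _ _ hσ hτ => rw [AlgEquiv.mul_apply, hτ, hσ]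
  | inv σ _ hσ =>
    conv_lhs => rw [← hσ]
    exact σ.symm_apply_apply z

/-- If there are at least two points above `0`, the distinguished point above `1` is determined. -/
theorem eq_zero_of_comp_eq_map {F : Type*} [Field F] (a : J → ℕ) (hJ : 2 ≤ Fintype.card J)
    (β : F[X]) (hβ : IsStandardModel a β) (σ : F →+* F) (u v : F)
    (h : β.map σ = β.comp (C u * X + C v)) (hu : u ≠ 0) : v = 0 := by
  have hpos : 1 < (β - 1).rootMultiplicity 0 := by
    rw [hβ.index_one.2]
    omega
  have hne : β - 1 ≠ 0 := fun h0 => by simp [h0] at hpos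
  obtain ⟨h1, h2⟩ := (one_lt_rootMultiplicity_iff_isRoot hne).mp hpos
  rw [IsRoot, derivative_sub, derivative_one, sub_zero] at h2
  by_contra hv
  have e1 := congrArg (eval 0) h
  nth_rw 1 [← map_zero σ] at e1
  rw [eval_map, eval₂_at_apply, hβ.index_one.1, map_one, eval_comp] at e1
  simp only [eval_add, eval_mul, eval_C, eval_X, mul_zero, zero_add] at e1
  have e2 := congrArg (fun f => eval 0 (derivative f)) h
  simp only [derivative_map, derivative_comp] at e2
  nth_rw 1 [← map_zero σ] at e2
  rw [eval_map, eval₂_at_apply, h2] at e2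
  simp [hu] at e2
  -- If `v ≠ 0`, it would be a second critical point above `1`.
  have h3 := hβ.unramified_one v hv e1.symm
  have h4 := (one_lt_rootMultiplicity_iff_isRoot (t := v) hne).mpr
    ⟨by simp [IsRoot, ← e1], by simp [IsRoot, e2]⟩
  omega

/-- Rescale by `u` to a standard model over the field of moduli. Its `φ_n` equals `u ^ n`, so `u` is
one of the radicals adjoined in the Kummer field, and the scaling can be undone there. -/
theorem coeff_mem_classKummerField (a : J → ℕ) (ha : ∀ j, 0 < a j) [Nonempty J] (γ : Qbar[X])
    (hγ : IsKummerModel a γ) (k : ℕ) : γ.coeff k ∈ classKummerField a := by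
  obtain ⟨y, hinj, hy, hφ, hφ1, rfl⟩ := exists_eq_treePoly_of_isKummerModel a γ hγ
  -- With a single entry the point above `1` is not determined by ramification, but the Kummer
  -- equation `a * y = 1` already makes `y` rational.
  rcases (Nat.lt_or_ge (Fintype.card J) 2) with hJ | hJ
  · have hJ1 : Fintype.card J = 1 := by
      have := Fintype.card_pos (α := J)
      omega
    obtain ⟨j, hj⟩ := Fintype.card_eq_one_iff.mp hJ1
    have : Unique J := ⟨⟨j⟩, hj⟩
    rw [hJ1, weightedPowerSum, Fintype.sum_unique, pow_one] at hφ1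
    let K := classKummerField a
    have hyK : ∀ i, ((((a i : K))⁻¹ : K) : Qbar) = y i := fun i => by
      rw [Unique.eq_default i, eq_inv_of_mul_eq_one_right hφ1]
      simp
    have : treePoly a y = (treePoly a fun i => ((a i : K))⁻¹).map (algebraMap K Qbar) := by
      rw [map_treePoly]
      exact congrArg _ (funext fun i => (hyK i).symm)
    rw [this, coeff_map]
    exact Subtype.prop _
  · obtain ⟨u, hu, hfix⟩ := exists_comp_forall_map_eq (treePoly a y)
    have hstd : IsStandardModel a ((treePoly a y).comp (C u * X)) := by
      rw [treePoly_comp_C_mul_X]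
      refine isStandardModel_treePoly_of_charZero a ha _ (fun j => mul_ne_zero hu (hy j))
        (fun i j h => hinj (mul_left_cancel₀ hu h)) fun m h1 h2 => ?_
      rw [weightedPowerSum_mul, hφ m h1 h2, mul_zero]
    set β := (treePoly a y).comp (C u * X) with hβ
    have hmoduli : ∀ k, β.coeff k ∈ fieldOfModuli β := by
      intro k
      refine mem_fieldOfModuli β _ fun σ hσ => ?_
      obtain ⟨w, v, hw, he⟩ := hσ
      obtain rfl := eq_zero_of_comp_eq_map a hJ β hstd _ w v he hw
      rw [C_0, add_zero] at he
      have := congrArg (fun f : Qbar[X] => f.coeff k) (hfix _ w hw he)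
      simpa using this
    have hle : fieldOfModuli β ⊔ IntermediateField.adjoin ℚ
        {z : Qbar | z ^ Fintype.card J = inversePowerSum (Fintype.card J) β} ≤ classKummerField a :=
      le_iSup₂_of_le β ⟨hstd, hmoduli⟩ le_rfl
    have hz : u ∈ classKummerField a := by
      refine hle (le_sup_right (a := fieldOfModuli β)
        (IntermediateField.subset_adjoin ℚ _ ?_))
      rw [Set.mem_ofPred_eq, hβ, treePoly_comp_C_mul_X,
        inversePowerSum_treePoly a _ (fun j => mul_ne_zero hu (hy j)), weightedPowerSum_mul, hφ1,
        mul_one]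
    have hk : (treePoly a y).coeff k = β.coeff k * (u ^ k)⁻¹ := by
      rw [hβ, comp_C_mul_X_coeff, mul_inv_cancel_right₀ (pow_ne_zero _ hu)]
    rw [hk]
    exact mul_mem (hle (le_sup_left (a := fieldOfModuli β) (hmoduli k)))
      (inv_mem (pow_mem hz k))

end KummerField

/-! ### Reduction of models at a valuation ring. -/

section ModelReduction

variable {J : Type*} [Fintype J]

open IsLocalRing

theorem rootMultiplicity_comp_X_add_C {F : Type*} [Field F] (f : F[X]) (c t : F) :
    (f.comp (X + C c)).rootMultiplicity t = f.rootMultiplicity (t + c) := by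
  rw [rootMultiplicity_eq_rootMultiplicity (p := f), rootMultiplicity_eq_rootMultiplicity, comp_assoc]
  congr 2
  simp [add_assoc]

theorem IsModelAt.isStandardModel_comp {F : Type*} [Field F] {a : J → ℕ} {β : F[X]} {c : F}
    (h : IsModelAt a β c) : IsStandardModel a (β.comp (X + C c)) := by
  have hmult : ∀ t, (β.comp (X + C c) - 1).rootMultiplicity t = (β - 1).rootMultiplicity (t + c) :=
    fun t => by rw [← rootMultiplicity_comp_X_add_C, sub_comp, one_comp]
  obtain ⟨r, hinj, hr, hm⟩ := h.fibre_zero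
  refine ⟨fun t ht => ?_, ⟨fun j => r j - c, fun i j e => hinj (sub_left_injective e), fun t => ?_,
    fun j => ?_⟩, ⟨by simpa using h.index_one.1, ?_⟩, fun t ht h1 => ?_, h.tame_zero, h.tame_one, ?_⟩
  · simpa using h.etale (t + c) (by simpa [derivative_comp] using ht)
  · have := hr (t + c)
    simpa [eq_sub_iff_add_eq, sub_eq_iff_eq_add] using this
  · rw [rootMultiplicity_comp_X_add_C, sub_add_cancel, hm]
  · rw [hmult, zero_add]
    exact h.index_one.2
  · rw [hmult]
    exact h.unramified_one _ (by simpa using ht) (by simpa using h1)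
  · rw [natDegree_comp, natDegree_X_add_C, mul_one]
    exact h.tame_infty

theorem natCast_ne_zero_of_ringHom {k L : Type*} [Field k] [Field L] (f : k →+* L) {n : ℕ}
    (h : (n : k) ≠ 0) : (n : L) ≠ 0 := by
  rw [← map_natCast f]
  exact (map_ne_zero f).mpr h

theorem injective_and_ne_zero_of_weightedPowerSum_eq_one {k : Type*} [Field k] [Nonempty J]
    (a : J → ℕ) (hS : ∀ S : Finset J, S.Nonempty → ((∑ j ∈ S, a j : ℕ) : k) ≠ 0) (y : J → k)
    (h : ∀ m, 1 ≤ m → m < Fintype.card J → weightedPowerSum a y m = 0)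
    (h1 : weightedPowerSum a y (Fintype.card J) = 1) : Function.Injective y ∧ ∀ j, y j ≠ 0 := by
  obtain ⟨j, hj⟩ := ne_zero_of_weightedPowerSum_eq_one a y Fintype.card_ne_zero h1
  exact injective_and_ne_zero_of_weightedPowerSum_eq_zero a y hS h j hj

theorem isKummerModel_treePoly {k : Type*} [Field k] [Nonempty J]
    (a : J → ℕ) (hS : ∀ S : Finset J, S.Nonempty → ((∑ j ∈ S, a j : ℕ) : k) ≠ 0)
    (hN : ∀ m, 1 ≤ m → m ≤ Fintype.card J → (m : k) ≠ 0) (y : J → k)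
    (h : ∀ m, 1 ≤ m → m < Fintype.card J → weightedPowerSum a y m = 0)
    (h1 : weightedPowerSum a y (Fintype.card J) = 1) : IsKummerModel a (treePoly a y) := by
  obtain ⟨hinj, hy⟩ := injective_and_ne_zero_of_weightedPowerSum_eq_one a hS y h h1
  refine ⟨isStandardModel_treePoly a (fun j => ?_) (hS _ Finset.univ_nonempty) hN y hy hinj h, ?_⟩
  · simpa using hS {j} (Finset.singleton_nonempty j)
  · rw [inversePowerSum_treePoly a y hy, h1]

variable {F : Type*} [Field F] (A : ValuationSubring F) (a : J → ℕ)

theorem coe_weightedPowerSum (z : J → A) (m : ℕ) :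
    ((weightedPowerSum a z m : A) : F) = weightedPowerSum a (fun j => (z j : F)) m :=
  map_weightedPowerSum A.subtype a z m

theorem exists_coe_eq_of_weightedPowerSum_eq
    (hS : ∀ S : Finset J, S.Nonempty → ((∑ j ∈ S, a j : ℕ) : ResidueField A) ≠ 0) (y : J → F)
    (c : ℕ → A) (h : ∀ m, 1 ≤ m → m ≤ Fintype.card J → weightedPowerSum a y m = c m) :
    ∃ z : J → A, (∀ j, (z j : F) = y j) ∧
      ∀ m, 1 ≤ m → m ≤ Fintype.card J → weightedPowerSum a z m = c m := by
  have hy := mem_of_weightedPowerSum_mem A a hS y fun m h1 h2 => by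
    rw [h m h1 h2]
    exact (c m).2
  refine ⟨fun j => ⟨y j, hy j⟩, fun j => rfl, fun m h1 h2 => Subtype.ext ?_⟩
  rw [coe_weightedPowerSum]
  exact h m h1 h2

/-- The values `0, …, 0, 1` prescribed by a Kummer model. -/
def kummerTarget (R : Type*) [CommRing R] (N m : ℕ) : R := if m = N then 1 else 0

theorem map_kummerTarget {R S : Type*} [CommRing R] [CommRing S] (f : R →+* S) (N m : ℕ) :
    f (kummerTarget R N m) = kummerTarget S N m := by
  unfold kummerTarget
  split_ifs <;> simp

theorem weightedPowerSum_eq_kummerTarget_iff {R : Type*} [CommRing R] [Nonempty J] (y : J → R) :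
    (∀ m, 1 ≤ m → m ≤ Fintype.card J → weightedPowerSum a y m = kummerTarget R (Fintype.card J) m) ↔
      (∀ m, 1 ≤ m → m < Fintype.card J → weightedPowerSum a y m = 0) ∧
        weightedPowerSum a y (Fintype.card J) = 1 := by
  have hpos : 1 ≤ Fintype.card J := Fintype.card_pos
  constructor
  · intro h
    refine ⟨fun m h1 h2 => ?_, ?_⟩
    · rw [h m h1 h2.le, kummerTarget, if_neg h2.ne]
    · rw [h _ hpos le_rfl, kummerTarget, if_pos rfl]
  · rintro ⟨h, h'⟩ m h1 h2
    rcases h2.lt_or_eq with h3 | rfl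
    · rw [h m h1 h3, kummerTarget, if_neg h3.ne]
    · rw [h', kummerTarget, if_pos rfl]

theorem weightedPowerSum_residue_eq_kummerTarget (z : J → A)
    (hz : ∀ m, 1 ≤ m → m ≤ Fintype.card J →
      weightedPowerSum a z m = kummerTarget A (Fintype.card J) m) :
    ∀ m, 1 ≤ m → m ≤ Fintype.card J →
      weightedPowerSum a (fun j => residue A (z j)) m =
        kummerTarget (ResidueField A) (Fintype.card J) m := fun m h1 h2 => by
  rw [← map_weightedPowerSum, hz m h1 h2, map_kummerTarget]

variable [IsAlgClosed F]

/-- Scale to the Kummer normalization: the coordinates become integral with distinct nonzero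
residues, hence units. Dividing by one of them gives a normalized model that stays nondegenerate
modulo the maximal ideal. -/
theorem exists_normalizedModel_reduction [CharZero F] [Nonempty J] (ha : ∀ j, 0 < a j)
    (hS : ∀ S : Finset J, S.Nonempty → ((∑ j ∈ S, a j : ℕ) : ResidueField A) ≠ 0)
    (hN : ∀ m, 1 ≤ m → m ≤ Fintype.card J → (m : ResidueField A) ≠ 0)
    (β : F[X]) (hβ : IsModel a β) :
    ∃ B : A[X], SameTree β (B.map (algebraMap A F)) ∧ IsNormalizedModel a (B.map (algebraMap A F)) ∧
      IsNormalizedModel a (B.map (algebraMap A (AlgebraicClosure (ResidueField A)))) := by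
  obtain ⟨c, hc⟩ := hβ
  obtain ⟨y, hinj, hy, hφ, hβy⟩ := exists_eq_treePoly_of_isStandardModel a _ hc.isStandardModel_comp
  have hcard : 0 < Fintype.card J := Fintype.card_pos
  have ha' : ∀ j, a j ≠ 0 := fun j => (ha j).ne'
  have hφN := weightedPowerSum_card_ne_zero a (fun j => Nat.cast_ne_zero.mpr (ha' j)) y hy hinj hφ
  obtain ⟨u, hu⟩ := IsAlgClosed.exists_pow_nat_eq (weightedPowerSum a y (Fintype.card J))⁻¹ hcard
  have hu0 : u ≠ 0 := fun h => by
    rw [h, zero_pow hcard.ne'] at hu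
    exact inv_ne_zero hφN hu.symm
  obtain ⟨z, hz, hzφ⟩ := exists_coe_eq_of_weightedPowerSum_eq A a hS (fun j => u * y j)
    (kummerTarget A (Fintype.card J)) (fun m h1 h2 => by
      rw [show ((kummerTarget A (Fintype.card J) m : A) : F) = kummerTarget F (Fintype.card J) m from
        map_kummerTarget A.subtype _ _]
      revert m
      rw [weightedPowerSum_eq_kummerTarget_iff]
      refine ⟨fun m h1 h2 => ?_, ?_⟩
      · rw [weightedPowerSum_mul, hφ m h1 h2, mul_zero]
      · rw [weightedPowerSum_mul, hu, inv_mul_cancel₀ hφN])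
  have hres := (weightedPowerSum_eq_kummerTarget_iff a fun j => residue A (z j)).mp
    fun m h1 h2 => by rw [← map_weightedPowerSum, hzφ m h1 h2, map_kummerTarget]
  obtain ⟨hrinj, hr0⟩ := injective_and_ne_zero_of_weightedPowerSum_eq_one a hS _ hres.1 hres.2
  obtain ⟨j₀⟩ := ‹Nonempty J›
  obtain ⟨v, hv⟩ := ((residue_ne_zero_iff_isUnit _).mp (hr0 j₀)).exists_left_inv
  have hvF : ((v : A) : F) = (u * y j₀)⁻¹ := by
    rw [← hz]
    exact eq_inv_of_mul_eq_one_left (congrArg (fun t : A => (t : F)) hv)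
  have hw : ∀ j, ((v * z j : A) : F) = (y j₀)⁻¹ * y j := fun j => by
    change (v : F) * z j = _
    rw [hvF, hz, mul_inv, mul_mul_mul_comm, inv_mul_cancel₀ hu0, one_mul]
  have hmapF : (treePoly a fun j => v * z j).map (algebraMap A F) =
      treePoly a fun j => (y j₀)⁻¹ * y j := by
    rw [map_treePoly]
    exact congrArg _ (funext hw)
  refine ⟨treePoly a fun j => v * z j, ⟨(y j₀)⁻¹, c, inv_ne_zero (hy j₀), ?_⟩, ?_, ?_⟩
  · rw [hmapF, ← treePoly_comp_C_mul_X, ← hβy, comp_assoc]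
    simp
  · rw [hmapF]
    have : Nonempty J := ⟨j₀⟩
    refine ⟨isStandardModel_treePoly_of_charZero a ha _
      (fun j => mul_ne_zero (inv_ne_zero (hy j₀)) (hy j))
      (fun i j h => hinj (mul_left_cancel₀ (inv_ne_zero (hy j₀)) h)) fun m h1 h2 => ?_, ?_⟩
    · rw [weightedPowerSum_mul, hφ m h1 h2, mul_zero]
    · exact (eval_treePoly_eq_zero_iff a ha' _ _).mpr ⟨j₀, by rw [mul_one, inv_mul_cancel₀ (hy j₀)]⟩
  · rw [map_treePoly]
    let ι := algebraMap (ResidueField A) (AlgebraicClosure (ResidueField A))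
    have hι : ∀ t : A, algebraMap A (AlgebraicClosure (ResidueField A)) t = ι (residue A t) :=
      fun t => IsScalarTower.algebraMap_apply A (ResidueField A) _ t
    simp only [hι, map_mul]
    have hv0 : ι (residue A v) ≠ 0 := by
      refine (map_ne_zero ι).mpr fun h => ?_
      have := congrArg (residue A) hv
      simp [h] at this
    have : Nonempty J := ⟨j₀⟩
    refine ⟨isStandardModel_treePoly a (fun j => natCast_ne_zero_of_ringHom ι ?_)
      (natCast_ne_zero_of_ringHom ι (hS _ Finset.univ_nonempty))
      (fun m h1 h2 => natCast_ne_zero_of_ringHom ι (hN m h1 h2)) _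
      (fun j => mul_ne_zero hv0 ((map_ne_zero ι).mpr (hr0 j)))
      (fun i j h => hrinj (ι.injective (mul_left_cancel₀ hv0 h))) fun m h1 h2 => ?_, ?_⟩
    · simpa using hS {j} (Finset.singleton_nonempty j)
    · rw [weightedPowerSum_mul, ← map_weightedPowerSum, hres.1 m h1 h2, map_zero, mul_zero]
    · refine (eval_treePoly_eq_zero_iff a ha' _ _).mpr ⟨j₀, ?_⟩
      rw [mul_one, ← map_mul, ← map_mul, hv, map_one, map_one]

/-- The coordinates of a Kummer model are integral, and their residues define a Kummer model. -/
theorem exists_integral_coordinates_of_isKummerModel [Nonempty J]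
    (hS : ∀ S : Finset J, S.Nonempty → ((∑ j ∈ S, a j : ℕ) : ResidueField A) ≠ 0)
    (γ : F[X]) (hγ : IsKummerModel a γ) :
    ∃ z : J → A, γ = treePoly a (fun j => (z j : F)) ∧
      ∀ m, 1 ≤ m → m ≤ Fintype.card J → weightedPowerSum a z m = kummerTarget A (Fintype.card J) m := by
  obtain ⟨y, -, -, hφ, hφ1, rfl⟩ := exists_eq_treePoly_of_isKummerModel a γ hγ
  obtain ⟨z, hz, h⟩ := exists_coe_eq_of_weightedPowerSum_eq A a hS y
    (kummerTarget A (Fintype.card J)) fun m h1 h2 => by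
      rw [show ((kummerTarget A (Fintype.card J) m : A) : F) = kummerTarget F (Fintype.card J) m from
        map_kummerTarget A.subtype _ _]
      exact (weightedPowerSum_eq_kummerTarget_iff a y).mpr ⟨hφ, hφ1⟩ m h1 h2
  exact ⟨z, by simp only [hz], h⟩

end ModelReduction

/-! ### Passing between `𝔭` and a valuation ring of `Qbar` above it. -/

section NumberFieldReduction

open IsLocalRing

variable (K : IntermediateField ℚ Qbar) [NumberField K] (𝔭 : HeightOneSpectrum (𝓞 K))

/-- Some valuation ring dominates the local ring at `𝔭`. Domination gives equality on `K`: if `t`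
lies above and `t⁻¹` below, then `t⁻¹` becomes a unit above and so already was one. -/
theorem exists_valuationSubring_comap_eq :
    ∃ A : ValuationSubring Qbar, A.comap (algebraMap K Qbar) = localRingAt K 𝔭 := by
  obtain ⟨A, hA, hloc⟩ := IsLocalRing.exists_factor_valuationRing
    ((algebraMap K Qbar).comp (localRingAt K 𝔭).subtype)
  refine ⟨A, ?_⟩
  ext t
  rw [ValuationSubring.mem_comap]
  refine ⟨fun ht => ?_, fun ht => hA ⟨t, ht⟩⟩
  rcases (localRingAt K 𝔭).mem_or_inv_mem t with h | h
  · exact h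
  · by_cases h0 : t = 0
    · rw [h0]
      exact zero_mem _
    have hunit : IsUnit (⟨t⁻¹, h⟩ : localRingAt K 𝔭) := by
      refine hloc.map_nonunit _ (isUnit_iff_exists_inv.mpr ⟨⟨algebraMap K Qbar t, ht⟩, ?_⟩)
      apply Subtype.ext
      change algebraMap K Qbar t⁻¹ * algebraMap K Qbar t = 1
      rw [← map_mul, inv_mul_cancel₀ h0, map_one]
    obtain ⟨w, hw⟩ := hunit.exists_right_inv
    have hw' : t⁻¹ * (w : K) = 1 := congrArg (fun r : localRingAt K 𝔭 => (r : K)) hw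
    rw [inv_mul_eq_one₀ h0] at hw'
    rw [hw']
    exact w.2

variable {K 𝔭} {A : ValuationSubring Qbar}

theorem mem_localRingAt_iff (hA : A.comap (algebraMap K Qbar) = localRingAt K 𝔭) (t : K) :
    t ∈ localRingAt K 𝔭 ↔ (t : Qbar) ∈ A := by
  rw [← hA]
  rfl

theorem residue_eq_zero_iff_valuation_lt_one
    (hA : A.comap (algebraMap K Qbar) = localRingAt K 𝔭) (t : K) (ht : (t : Qbar) ∈ A) :
    residue A ⟨t, ht⟩ = 0 ↔ 𝔭.valuation K t < 1 := by
  rw [residue_eq_zero_iff, A.valuation_lt_one_iff]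
  change A.valuation (t : Qbar) < 1 ↔ _
  by_cases h0 : t = 0
  · simp [h0]
  have key := mem_localRingAt_iff hA t⁻¹
  rw [Valuation.mem_valuationSubring_iff, map_inv₀] at key
  have h1 : A.valuation (t : Qbar) ≠ 0 := by simpa using h0
  have h2 : 𝔭.valuation K t ≠ 0 := by simpa using h0
  rw [← not_le, ← not_le, not_iff_not, ← inv_le_one₀ (zero_lt_iff.mpr h1),
    ← inv_le_one₀ (zero_lt_iff.mpr h2), key, ← map_inv₀, A.valuation_le_one_iff]
  simp

theorem natCast_residueField_eq_zero (hA : A.comap (algebraMap K Qbar) = localRingAt K 𝔭) {p : ℕ}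
    (h𝔭 : 𝔭.asIdeal.LiesOver (Ideal.span {(p : ℤ)})) : (p : ResidueField A) = 0 := by
  have hp : (p : 𝓞 K) ∈ 𝔭.asIdeal := by
    have h1 : (p : ℤ) ∈ Ideal.span {(p : ℤ)} := Ideal.mem_span_singleton_self _
    rw [h𝔭.over] at h1
    simpa using h1
  have h2 := (residue_eq_zero_iff_valuation_lt_one hA (p : K) (by simp)).mpr (by
    simpa using (𝔭.valuation_lt_one_iff_mem (K := K) (p : 𝓞 K)).mpr hp)
  rw [← map_natCast (residue A) p, ← h2]
  congr 1

theorem exists_algebraicClosure_lift {k L : Type*} [Field k] [Field L] [IsAlgClosed L] (f : k →+* L) :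
    ∃ g : AlgebraicClosure k →+* L, g.comp (algebraMap k (AlgebraicClosure k)) = f := by
  let _ : Algebra k L := f.toAlgebra
  let g : AlgebraicClosure k →ₐ[k] L := IsAlgClosed.lift
  exact ⟨g, RingHom.ext g.commutes⟩

/-- The coordinates lie in `A` but perhaps not in `K`. The reduction is computed over the residue
field of `A`, and its factorization is then pulled back to the algebraic closure of `k(𝔭)`. -/
theorem reducesToKummerModel_of_coeff_mem {J : Type*} [Fintype J] [Nonempty J] (a : J → ℕ)
    (ha : ∀ j, 0 < a j) (hA : A.comap (algebraMap K Qbar) = localRingAt K 𝔭)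
    (hS : ∀ S : Finset J, S.Nonempty → ((∑ j ∈ S, a j : ℕ) : ResidueField A) ≠ 0)
    (hN : ∀ m, 1 ≤ m → m ≤ Fintype.card J → (m : ResidueField A) ≠ 0) (γ : Qbar[X])
    (hγ : IsKummerModel a γ) (hK : ∀ k, γ.coeff k ∈ K) : ReducesToKummerModel K 𝔭 a γ := by
  obtain ⟨z, rfl, hz⟩ := exists_integral_coordinates_of_isKummerModel A a hS γ hγ
  have hcoeA : (treePoly a z).map (algebraMap A Qbar) = treePoly a fun j => (z j : Qbar) :=
    map_treePoly _ _ _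
  have hres := weightedPowerSum_residue_eq_kummerTarget A a z hz
  let O := localRingAt K 𝔭
  obtain ⟨B, hB⟩ : treePoly a (fun j => (z j : Qbar)) ∈
      Polynomial.lifts ((algebraMap K Qbar).comp (algebraMap O K)) := by
    rw [lifts_iff_coeff_lifts]
    intro k
    have hmem : (⟨_, hK k⟩ : K) ∈ O := by
      rw [mem_localRingAt_iff hA]
      change (treePoly a fun j => (z j : Qbar)).coeff k ∈ A
      rw [← hcoeA, coeff_map]
      exact ((treePoly a z).coeff k).2
    exact ⟨⟨_, hmem⟩, rfl⟩
  rw [coe_mapRingHom] at hB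
  refine ⟨B, hB, ?_⟩
  let k := AlgebraicClosure (ResidueField O)
  let L := AlgebraicClosure (ResidueField A)
  let f : O →+* A := ((algebraMap K Qbar).comp (algebraMap O K)).codRestrict A
    fun t => (mem_localRingAt_iff hA t).mp t.2
  have hloc : IsLocalHom f := by
    refine ⟨fun t ht => ?_⟩
    obtain ⟨w, hw⟩ := ht.exists_right_inv
    have hw' : ((t : K) : Qbar) * (w : Qbar) = 1 := congrArg (fun r : A => (r : Qbar)) hw
    have ht0 : (t : K) ≠ 0 := fun h => by simp [h] at hw'
    have hmem : (t : K)⁻¹ ∈ O := by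
      rw [mem_localRingAt_iff hA]
      change ((t : K) : Qbar)⁻¹ ∈ A
      rw [inv_eq_of_mul_eq_one_right hw']
      exact w.2
    exact isUnit_iff_exists_inv.mpr ⟨⟨_, hmem⟩, Subtype.ext (mul_inv_cancel₀ ht0)⟩
  let ι₀ : ResidueField O →+* L := (algebraMap (ResidueField A) L).comp (ResidueField.map f)
  obtain ⟨ι, hι⟩ := exists_algebraicClosure_lift ι₀
  have hBA : B.map f = treePoly a z := by
    apply Polynomial.map_injective (algebraMap A Qbar) (IsFractionRing.injective A Qbar)
    rw [hcoeA, ← hB, Polynomial.map_map]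
    rfl
  have hcomp : ι.comp (algebraMap O k) =
      ((algebraMap (ResidueField A) L).comp (residue A)).comp f := by
    ext t
    change ι (algebraMap O k t) = algebraMap (ResidueField A) L (residue A (f t))
    rw [IsScalarTower.algebraMap_apply O (ResidueField O) k]
    exact congrArg (fun g : ResidueField O →+* L => g (residue O t)) hι
  have hmap : (B.map (algebraMap O k)).map ι =
      treePoly a fun j => algebraMap (ResidueField A) L (residue A (z j)) := by
    rw [Polynomial.map_map, hcomp, ← Polynomial.map_map, hBA, map_treePoly]
    rfl
  have hr0 := (injective_and_ne_zero_of_weightedPowerSum_eq_one a hS _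
    ((weightedPowerSum_eq_kummerTarget_iff a _).mp hres).1
    ((weightedPowerSum_eq_kummerTarget_iff a _).mp hres).2).2
  obtain ⟨w, hw, hBw⟩ := exists_treePoly_of_map_eq ι a (fun j => (ha j).ne') _
    (fun j => (_root_.map_ne_zero _).mpr (hr0 j)) _ hmap
  have hnat : ∀ n : ℕ, (n : ResidueField A) ≠ 0 → (n : k) ≠ 0 := fun n hn h => by
    refine natCast_ne_zero_of_ringHom (algebraMap (ResidueField A) L) hn ?_
    rw [← map_natCast ι, h, map_zero]
  have hwφ : ∀ m, 1 ≤ m → m ≤ Fintype.card J →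
      weightedPowerSum a w m = kummerTarget k (Fintype.card J) m := fun m h1 h2 => by
    apply ι.injective
    rw [map_weightedPowerSum, map_kummerTarget]
    simp only [hw]
    rw [← map_weightedPowerSum, hres m h1 h2, map_kummerTarget]
  rw [hBw]
  rw [weightedPowerSum_eq_kummerTarget_iff] at hwφ
  exact isKummerModel_treePoly a (fun S hne => hnat _ (hS S hne)) (fun m h1 h2 => hnat _ (hN m h1 h2))
    w hwφ.1 hwφ.2

/-- Write `t` as a fraction with denominator outside `𝔭`; this form is preserved by `τ`. -/
theorem valuation_le_one_of_mem_stabilizer (τ : K ≃ₐ[ℚ] K)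
    (hτ : τ ∈ MulAction.stabilizer (K ≃ₐ[ℚ] K) 𝔭.asIdeal) (t : K) (ht : 𝔭.valuation K t ≤ 1) :
    𝔭.valuation K (τ t) ≤ 1 := by
  obtain ⟨n, d, hnd⟩ := 𝔭.exists_primeCompl_mul_eq_of_integer t ht
  have hstab : ∀ r : 𝓞 K, τ • r ∈ 𝔭.asIdeal → r ∈ 𝔭.asIdeal := fun r h => by
    rw [← MulAction.mem_stabilizer_iff.mp hτ] at h
    exact Ideal.smul_mem_pointwise_smul_iff.mp h
  have hd : τ • (d : 𝓞 K) ∉ 𝔭.asIdeal := fun h => d.2 (hstab _ h)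
  have hd1 : 𝔭.valuation K (algebraMap (𝓞 K) K (τ • (d : 𝓞 K))) = 1 :=
    le_antisymm (𝔭.valuation_le_one _)
      (not_lt.mp fun h => hd ((𝔭.valuation_lt_one_iff_mem _).mp h))
  have h1 : τ t * algebraMap (𝓞 K) K (τ • (d : 𝓞 K)) = algebraMap (𝓞 K) K (τ • n) := by
    change τ t * τ (algebraMap (𝓞 K) K d) = τ (algebraMap (𝓞 K) K n)
    rw [← map_mul, hnd]
  have h2 := congrArg (𝔭.valuation K) h1
  rw [map_mul, hd1, mul_one] at h2
  rw [h2]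
  exact 𝔭.valuation_le_one _

theorem valuation_lt_one_of_mem_stabilizer (τ : K ≃ₐ[ℚ] K)
    (hτ : τ ∈ MulAction.stabilizer (K ≃ₐ[ℚ] K) 𝔭.asIdeal) (t : K) (ht : 𝔭.valuation K t < 1) :
    𝔭.valuation K (τ t) < 1 := by
  refine lt_of_le_of_ne (valuation_le_one_of_mem_stabilizer τ hτ t ht.le) fun h1 => ?_
  have h2 := valuation_le_one_of_mem_stabilizer τ⁻¹ (inv_mem hτ) (τ t)⁻¹ (by rw [map_inv₀, h1, inv_one])
  have h3 : τ⁻¹ (τ t)⁻¹ = t⁻¹ := by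
    rw [map_inv₀]
    exact congrArg _ (τ.symm_apply_apply t)
  have h0 : 𝔭.valuation K t ≠ 0 := by
    intro h0
    rw [Valuation.zero_iff] at h0
    simp [h0] at h1
  rw [h3, map_inv₀, inv_le_one₀ (zero_lt_iff.mpr h0)] at h2
  exact absurd ht (not_lt.mpr h2)

end NumberFieldReduction

/-! ### The substitution `x_j = 1 + x y_j`. -/

section Shift

/-- The moments up to degree `d` are those of a mass `s` placed at the single point `e`; by the
binomial formula, translation just moves that point. -/
theorem weightedPowerSum_add_const {J : Type*} [Fintype J] {R : Type*} [CommRing R] (a : J → ℕ)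
    (y : J → R) (e s t : R) {d : ℕ} (h : ∀ m ≤ d, weightedPowerSum a y m = e ^ m * s) :
    ∀ m ≤ d, weightedPowerSum a (fun j => y j + t) m = (e + t) ^ m * s := by
  intro m hm
  simp only [weightedPowerSum, add_pow, Finset.mul_sum, Finset.sum_mul]
  rw [Finset.sum_comm]
  refine Finset.sum_congr rfl fun k hk => ?_
  have := h k (by rw [Finset.mem_range] at hk; omega)
  rw [weightedPowerSum] at this
  rw [show e ^ k * t ^ (m - k) * (m.choose k : R) * s = e ^ k * s * (t ^ (m - k) * (m.choose k : R)) by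
    ring, ← this, Finset.sum_mul]
  exact Finset.sum_congr rfl fun j _ => by ring

variable {n : ℕ} {R : Type*} [CommRing R]

/-- The tuple with entry `1` at `i` and entries `1 + x y_j` at `j ≠ i`. -/
def shiftedTuple (i : Fin n) (x : R) (y : {j : Fin n // j ≠ i} → R) (j : Fin n) : R :=
  if h : j = i then 1 else 1 + x * y ⟨j, h⟩

theorem shiftedTuple_self (i : Fin n) (x : R) (y : {j : Fin n // j ≠ i} → R) :
    shiftedTuple i x y i = 1 := by
  simp [shiftedTuple]

theorem shiftedTuple_coe (i : Fin n) (x : R) (y : {j : Fin n // j ≠ i} → R) (j : {j : Fin n // j ≠ i}) :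
    shiftedTuple i x y j = 1 + x * y j := by
  simp [shiftedTuple, j.2]

theorem map_shiftedTuple {S : Type*} [CommRing S] (f : R →+* S) (i : Fin n) (x : R)
    (y : {j : Fin n // j ≠ i} → R) (j : Fin n) :
    f (shiftedTuple i x y j) = shiftedTuple i (f x) (fun l => f (y l)) j := by
  unfold shiftedTuple
  split_ifs <;> simp

theorem treePoly_shiftedTuple (a : Fin n → ℕ) (i : Fin n) (x : R) (y : {j : Fin n // j ≠ i} → R) :
    treePoly a (shiftedTuple i x y) =
      (1 - X) ^ a i * treePoly (omitEntry a i) fun j => 1 + x * y j := by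
  rw [treePoly, Fintype.prod_eq_mul_prod_subtype_ne _ i, shiftedTuple_self, C_1, one_mul]
  simp only [shiftedTuple_coe]
  rfl

theorem weightedPowerSum_omitEntry (a : Fin n → ℕ) (i : Fin n) (y : Fin n → R) (m : ℕ) :
    weightedPowerSum a y m =
      a i * y i ^ m + weightedPowerSum (omitEntry a i) (fun j => y j) m := by
  rw [weightedPowerSum, Fintype.sum_eq_add_sum_subtype_ne _ i]
  rfl

/-- The weighted power sums of `(x_j - 1) / x`, for `j ≠ i`, when the first `N` weighted power sums of
the `x_j` vanish and `x_i = 1`. -/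
def deformedTarget (x : R) (N m : ℕ) : R := (-1) ^ (N + m) * x ^ (N - m)

theorem map_deformedTarget {S : Type*} [CommRing S] (f : R →+* S) (x : R) (N m : ℕ) :
    f (deformedTarget x N m) = deformedTarget (f x) N m := by
  simp [deformedTarget]

/-- This is the degeneration from normalized to Kummer equations: at `x = 0` only `m = N` survives,
with sign `(-1) ^ (2 * N)`. -/
theorem deformedTarget_zero {N m : ℕ} (hm : m ≤ N) :
    deformedTarget (0 : R) N m = kummerTarget R N m := by
  rcases hm.lt_or_eq with h | rfl
  · rw [deformedTarget, kummerTarget, if_neg h.ne, zero_pow (by omega), mul_zero]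
  · rw [deformedTarget, kummerTarget, if_pos rfl, Nat.sub_self, pow_zero, mul_one, ← two_mul,
      Even.neg_one_pow (even_two_mul _)]

variable {F : Type*} [Field F] (a : Fin n → ℕ) (i : Fin n) {N : ℕ} {x : F}

/-- After subtracting `1` the `i`-th coordinate is `0`, and the moments are those of the total mass
at `-1`, by the choice of `x ^ N`. Translating back places this mass at `0`, whose positive moments
vanish. -/
theorem weightedPowerSum_shiftedTuple (hx : x ^ N = (-1) ^ N * ((∑ j, a j : ℕ) : F))
    (y : {j : Fin n // j ≠ i} → F)
    (hy : ∀ m, 1 ≤ m → m ≤ N → weightedPowerSum (omitEntry a i) y m = deformedTarget x N m) (m : ℕ)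
    (h1 : 1 ≤ m) (h2 : m ≤ N) : weightedPowerSum a (shiftedTuple i x y) m = 0 := by
  have key : ∀ m ≤ N, weightedPowerSum a (fun j => shiftedTuple i x y j + -1) m =
      (-1) ^ m * ((∑ j, a j : ℕ) : F) := by
    intro m hm
    rcases Nat.eq_zero_or_pos m with rfl | hpos
    · simp [weightedPowerSum]
    · rw [weightedPowerSum_omitEntry a i, shiftedTuple_self, add_neg_cancel, zero_pow hpos.ne', mul_zero,
        zero_add]
      have : (fun j : {j : Fin n // j ≠ i} => shiftedTuple i x y j + -1) = fun j => x * y j := by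
        funext j
        rw [shiftedTuple_coe]
        ring
      rw [this, weightedPowerSum_mul, hy m hpos hm, deformedTarget]
      have h3 : x ^ m * x ^ (N - m) = x ^ N := by rw [← pow_add, Nat.add_sub_cancel' hm]
      have h4 : ((-1 : F) ^ N) * (-1) ^ N = 1 := by
        rw [← pow_add, ← two_mul, Even.neg_one_pow (even_two_mul _)]
      rw [pow_add]
      linear_combination ((-1) ^ N * (-1) ^ m : F) * h3 + ((-1) ^ N * (-1) ^ m : F) * hx +
        ((-1) ^ m * ((∑ j, a j : ℕ) : F)) * h4
  have := weightedPowerSum_add_const a _ _ _ 1 key m h2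
  simpa [show m ≠ 0 by omega] using this

theorem exists_eq_shiftedTuple (hx0 : x ≠ 0) (hx : x ^ N = (-1) ^ N * ((∑ j, a j : ℕ) : F))
    (z : Fin n → F) (hzi : z i = 1) (hz : ∀ m, 1 ≤ m → m ≤ N → weightedPowerSum a z m = 0) :
    ∃ y : {j : Fin n // j ≠ i} → F, z = shiftedTuple i x y ∧
      ∀ m, 1 ≤ m → m ≤ N → weightedPowerSum (omitEntry a i) y m = deformedTarget x N m := by
  have key : ∀ m ≤ N, weightedPowerSum a z m = 0 ^ m * ((∑ j, a j : ℕ) : F) := by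
    intro m hm
    rcases Nat.eq_zero_or_pos m with rfl | hpos
    · simp [weightedPowerSum]
    · rw [hz m hpos hm, zero_pow hpos.ne', zero_mul]
  have key' := weightedPowerSum_add_const a _ _ _ (-1) key
  refine ⟨fun j => x⁻¹ * (z j + -1), funext fun j => ?_, fun m h1 h2 => ?_⟩
  · by_cases h : j = i
    · rw [h, hzi, shiftedTuple_self]
    · rw [shiftedTuple, dif_neg h, mul_inv_cancel_left₀ hx0]
      ring
  · have h3 := key' m h2
    rw [weightedPowerSum_omitEntry a i, hzi, add_neg_cancel, zero_pow (by omega), mul_zero,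
      zero_add, zero_add] at h3
    rw [weightedPowerSum_mul, h3, deformedTarget, inv_pow, inv_mul_eq_iff_eq_mul₀ (pow_ne_zero _ hx0)]
    have h3 : x ^ m * x ^ (N - m) = x ^ N := by rw [← pow_add, Nat.add_sub_cancel' h2]
    have h4 : ((-1 : F) ^ N) * (-1) ^ N = 1 := by
      rw [← pow_add, ← two_mul, Even.neg_one_pow (even_two_mul _)]
    rw [pow_add]
    linear_combination -((-1) ^ N * (-1) ^ m : F) * h3 - ((-1) ^ N * (-1) ^ m : F) * hx -
        ((-1) ^ m * ((∑ j, a j : ℕ) : F)) * h4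

theorem shiftedTuple_injective_and_ne_zero [CharZero F] (hN : N + 1 = n) (ha : ∀ j, 0 < a j)
    (hx : x ^ N = (-1) ^ N * ((∑ j, a j : ℕ) : F)) (y : {j : Fin n // j ≠ i} → F)
    (hy : ∀ m, 1 ≤ m → m ≤ N → weightedPowerSum (omitEntry a i) y m = deformedTarget x N m) :
    Function.Injective (shiftedTuple i x y) ∧ ∀ j, shiftedTuple i x y j ≠ 0 := by
  refine injective_and_ne_zero_of_weightedPowerSum_eq_zero a _ (sum_cast_ne_zero a ha)
    (fun m h1 h2 => weightedPowerSum_shiftedTuple a i hx y hy m h1 ?_) i ?_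
  · rw [Fintype.card_fin] at h2
    omega
  · rw [shiftedTuple_self]
    exact one_ne_zero

theorem isNormalizedModelAt_treePoly [CharZero F] (hN : N + 1 = n) (ha : ∀ j, 0 < a j)
    (hx : x ^ N = (-1) ^ N * ((∑ j, a j : ℕ) : F)) (y : {j : Fin n // j ≠ i} → F)
    (hy : ∀ m, 1 ≤ m → m ≤ N → weightedPowerSum (omitEntry a i) y m = deformedTarget x N m) :
    IsNormalizedModelAt a i (treePoly a (shiftedTuple i x y)) := by
  obtain ⟨hinj, h0⟩ := shiftedTuple_injective_and_ne_zero a i hN ha hx y hy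
  have : Nonempty (Fin n) := ⟨i⟩
  refine ⟨⟨isStandardModel_treePoly_of_charZero a ha _ h0 hinj fun m h1 h2 =>
    weightedPowerSum_shiftedTuple a i hx y hy m h1 ?_, ?_⟩, ?_⟩
  · rw [Fintype.card_fin] at h2
    omega
  · exact (eval_treePoly_eq_zero_iff a (fun j => (ha j).ne') _ _).mpr
      ⟨i, by rw [shiftedTuple_self, mul_one]⟩
  · have := rootMultiplicity_treePoly a _ h0 hinj i
    rwa [shiftedTuple_self, inv_one] at this

theorem exists_shiftedTuple_of_isNormalizedModelAt [IsAlgClosed F] (hN : N + 1 = n)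
    (ha : ∀ j, 0 < a j) (hx0 : x ≠ 0) (hx : x ^ N = (-1) ^ N * ((∑ j, a j : ℕ) : F)) (β : F[X])
    (hβ : IsNormalizedModelAt a i β) :
    ∃ y : {j : Fin n // j ≠ i} → F, β = treePoly a (shiftedTuple i x y) ∧
      ∀ m, 1 ≤ m → m ≤ N → weightedPowerSum (omitEntry a i) y m = deformedTarget x N m := by
  obtain ⟨z, hinj, hz0, hφ, rfl⟩ := exists_eq_treePoly_of_isStandardModel a β hβ.1.1
  obtain ⟨l, hl⟩ := (eval_treePoly_eq_zero_iff a (fun j => (ha j).ne') _ _).mp hβ.1.2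
  rw [mul_one] at hl
  have hal : a l = a i := by
    have := rootMultiplicity_treePoly a z hz0 hinj l
    rwa [hl, inv_one, hβ.2, eq_comm] at this
  -- The coordinate equal to `1` may carry an index `l ≠ i`, but of the same weight; a swap moves it
  -- to `i`.
  have hswap : ∀ j, a (Equiv.swap i l j) = a j := fun j => by
    rw [Equiv.swap_apply_def]
    split_ifs with h1 h2
    · rw [h1, hal]
    · rw [h2, hal]
    · rfl
  obtain ⟨y, hy, hyφ⟩ := exists_eq_shiftedTuple a i hx0 hx (z ∘ Equiv.swap i l) (by simp [hl])
    fun m h1 h2 => by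
      rw [weightedPowerSum_comp_perm a z m _ hswap]
      exact hφ m h1 (by rw [Fintype.card_fin]; omega)
  exact ⟨y, by rw [← hy, treePoly_comp_perm a z _ hswap], hyφ⟩

end Shift

/-! ### Matching the two systems by residues. -/

section Correspondence

open IsLocalRing

variable {n : ℕ} {F : Type*} [Field F]

/-- `β = ∏ (1 - x_j X) ^ a_j`, with `x_i = 1`, is an `a_i`-normalized model and
`γ = ∏_{j ≠ i} (1 - z_j X) ^ a_j` is a Kummer model, with `z_j` integral and congruent to
`(x_j - 1) / x`. -/
def CongruentModels (A : ValuationSubring F) (a : Fin n → ℕ) (i : Fin n) (x : A) (β γ : F[X]) : Prop :=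
  ∃ y z : {j : Fin n // j ≠ i} → A,
    (∀ m, 1 ≤ m → m ≤ Fintype.card {j : Fin n // j ≠ i} → weightedPowerSum (omitEntry a i) y m =
      deformedTarget x (Fintype.card {j : Fin n // j ≠ i}) m) ∧
    (∀ m, 1 ≤ m → m ≤ Fintype.card {j : Fin n // j ≠ i} → weightedPowerSum (omitEntry a i) z m =
      kummerTarget A (Fintype.card {j : Fin n // j ≠ i}) m) ∧
    (∀ j, residue A (y j) = residue A (z j)) ∧
    β = treePoly a (shiftedTuple i (x : F) fun j => (y j : F)) ∧
    γ = treePoly (omitEntry a i) fun j => (z j : F)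

theorem card_subtype_ne_add_one (i : Fin n) : Fintype.card {j : Fin n // j ≠ i} + 1 = n := by
  have := i.pos
  rw [Fintype.card_subtype_compl, Fintype.card_fin]
  simp
  omega

variable {A : ValuationSubring F} {a : Fin n → ℕ} {i : Fin n} {x : A}

theorem coe_weightedPowerSum_eq_deformedTarget {N : ℕ} {y : {j : Fin n // j ≠ i} → A}
    (hy : ∀ m, 1 ≤ m → m ≤ N → weightedPowerSum (omitEntry a i) y m = deformedTarget x N m) :
    ∀ m, 1 ≤ m → m ≤ N →
      weightedPowerSum (omitEntry a i) (fun j => (y j : F)) m = deformedTarget (x : F) N m :=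
  fun m h1 h2 => by
    rw [← coe_weightedPowerSum, hy m h1 h2]
    exact map_deformedTarget A.subtype x N m

theorem CongruentModels.isNormalizedModelAt [CharZero F] {β γ : F[X]} (h : CongruentModels A a i x β γ)
    (ha : ∀ j, 0 < a j) (hx : (x : F) ^ Fintype.card {j : Fin n // j ≠ i} =
      (-1) ^ Fintype.card {j : Fin n // j ≠ i} * ((∑ j, a j : ℕ) : F)) : IsNormalizedModelAt a i β := by
  obtain ⟨y, z, hy, hz, hyz, rfl, rfl⟩ := h
  exact isNormalizedModelAt_treePoly a i (card_subtype_ne_add_one i) ha hx _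
    (coe_weightedPowerSum_eq_deformedTarget hy)

theorem coe_weightedPowerSum_eq_kummerTarget {J : Type*} [Fintype J] {b : J → ℕ} {N : ℕ} {z : J → A}
    (hz : ∀ m, 1 ≤ m → m ≤ N → weightedPowerSum b z m = kummerTarget A N m) :
    ∀ m, 1 ≤ m → m ≤ N → weightedPowerSum b (fun j => (z j : F)) m = kummerTarget F N m :=
  fun m h1 h2 => by
    rw [← coe_weightedPowerSum, hz m h1 h2]
    exact map_kummerTarget A.subtype N m

theorem CongruentModels.isKummerModel [CharZero F] [Nonempty {j : Fin n // j ≠ i}] {β γ : F[X]}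
    (h : CongruentModels A a i x β γ) (ha : ∀ j, 0 < a j) : IsKummerModel (omitEntry a i) γ := by
  obtain ⟨y, z, hy, hz, hyz, rfl, rfl⟩ := h
  have := (weightedPowerSum_eq_kummerTarget_iff _ _).mp (coe_weightedPowerSum_eq_kummerTarget hz)
  exact isKummerModel_treePoly (omitEntry a i) (sum_cast_ne_zero (omitEntry a i) fun j => ha j)
    (fun m hm _ => Nat.cast_ne_zero.mpr (by omega)) _ this.1 this.2

theorem weightedPowerSum_residue_of_deformedTarget (hxres : residue A x = 0) {N : ℕ}
    {y : {j : Fin n // j ≠ i} → A}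
    (hy : ∀ m, 1 ≤ m → m ≤ N → weightedPowerSum (omitEntry a i) y m = deformedTarget x N m) :
    ∀ m, 1 ≤ m → m ≤ N → weightedPowerSum (omitEntry a i) (fun j => residue A (y j)) m =
      kummerTarget (ResidueField A) N m := fun m h1 h2 => by
  rw [← map_weightedPowerSum, hy m h1 h2, map_deformedTarget, hxres, deformedTarget_zero h2]

/-- The residue of `x` is `0`, so both systems have the same reduction: the residues of a solution
of one lift to a solution of the other. The converse construction below is the same. -/
theorem exists_congruentModels_of_isNormalizedModelAt [IsAlgClosed F] (ha : ∀ j, 0 < a j)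
    (hS : ∀ S : Finset {j : Fin n // j ≠ i}, S.Nonempty →
      ((∑ j ∈ S, omitEntry a i j : ℕ) : ResidueField A) ≠ 0)
    (hxres : residue A x = 0) (hx0 : (x : F) ≠ 0)
    (hx : (x : F) ^ Fintype.card {j : Fin n // j ≠ i} =
      (-1) ^ Fintype.card {j : Fin n // j ≠ i} * ((∑ j, a j : ℕ) : F))
    (β : F[X]) (hβ : IsNormalizedModelAt a i β) : ∃ γ, CongruentModels A a i x β γ := by
  obtain ⟨y, rfl, hy⟩ := exists_shiftedTuple_of_isNormalizedModelAt a i (card_subtype_ne_add_one i)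
    ha hx0 hx β hβ
  obtain ⟨w, hw, hwφ⟩ := exists_coe_eq_of_weightedPowerSum_eq A (omitEntry a i) hS y
    (deformedTarget x (Fintype.card {j : Fin n // j ≠ i})) fun m h1 h2 => by
      rw [hy m h1 h2]
      exact (map_deformedTarget A.subtype x _ m).symm
  obtain ⟨z, hz, hzw⟩ := exists_weightedPowerSum_eq_of_residue A (omitEntry a i) hS
    (fun j => residue A (w j)) (kummerTarget A (Fintype.card {j : Fin n // j ≠ i})) fun m h1 h2 => by
      rw [weightedPowerSum_residue_of_deformedTarget hxres hwφ m h1 h2, map_kummerTarget]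
  exact ⟨_, w, z, hwφ, hz, fun j => (hzw j).symm, by simp only [hw], rfl⟩

theorem exists_congruentModels_of_isKummerModel [IsAlgClosed F] [Nonempty {j : Fin n // j ≠ i}]
    (hS : ∀ S : Finset {j : Fin n // j ≠ i}, S.Nonempty →
      ((∑ j ∈ S, omitEntry a i j : ℕ) : ResidueField A) ≠ 0)
    (hxres : residue A x = 0) (γ : F[X]) (hγ : IsKummerModel (omitEntry a i) γ) :
    ∃ β, CongruentModels A a i x β γ := by
  obtain ⟨z, rfl, hz⟩ := exists_integral_coordinates_of_isKummerModel A (omitEntry a i) hS γ hγ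
  obtain ⟨y, hy, hyz⟩ := exists_weightedPowerSum_eq_of_residue A (omitEntry a i) hS
    (fun j => residue A (z j)) (deformedTarget x (Fintype.card {j : Fin n // j ≠ i})) fun m h1 h2 => by
      rw [weightedPowerSum_residue_eq_kummerTarget A _ z hz m h1 h2, map_deformedTarget, hxres,
        deformedTarget_zero h2]
  exact ⟨_, y, z, hy, hz, hyz, rfl, rfl⟩

/-- Two integral solutions of the same system which are congruent up to a permutation. -/
theorem eq_comp_perm_of_residue_eq {J : Type*} [Fintype J] [Nonempty J] {b : J → ℕ}
    (hS : ∀ S : Finset J, S.Nonempty → ((∑ j ∈ S, b j : ℕ) : ResidueField A) ≠ 0)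
    (hN : ∀ m, 1 ≤ m → m ≤ Fintype.card J → (m : ResidueField A) ≠ 0) {c : ℕ → A} {y z : J → A}
    (hc : ∀ m, 1 ≤ m → m ≤ Fintype.card J →
      residue A (c m) = kummerTarget (ResidueField A) (Fintype.card J) m)
    (hy : ∀ m, 1 ≤ m → m ≤ Fintype.card J → weightedPowerSum b y m = c m)
    (hz : ∀ m, 1 ≤ m → m ≤ Fintype.card J → weightedPowerSum b z m = c m)
    (π : Equiv.Perm J) (hπ : ∀ j, b (π j) = b j) (h : ∀ j, residue A (z j) = residue A (y (π j))) :
    z = y ∘ π := by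
  have hzres : ∀ m, 1 ≤ m → m ≤ Fintype.card J →
      weightedPowerSum b (fun j => residue A (z j)) m =
        kummerTarget (ResidueField A) (Fintype.card J) m := fun m h1 h2 => by
    rw [← map_weightedPowerSum, hz m h1 h2, hc m h1 h2]
  rw [weightedPowerSum_eq_kummerTarget_iff] at hzres
  refine eq_of_weightedPowerSum_eq_of_residue_eq A b (fun j => ?_) hN z (y ∘ π) (fun m h1 h2 => ?_) h
    (injective_and_ne_zero_of_weightedPowerSum_eq_one b hS _ hzres.1 hzres.2).1
  · simpa using hS {j} (Finset.singleton_nonempty j)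
  · rw [weightedPowerSum_comp_perm b y m π hπ, hy m h1 h2, hz m h1 h2]

/-- The model `β` determines the `y j` up to a weight-preserving permutation, hence the residues of
the `z j`, and these determine the `z j`. -/
theorem CongruentModels.eq_right [Nonempty {j : Fin n // j ≠ i}] [CharZero F] (ha : ∀ j, 0 < a j)
    (hS : ∀ S : Finset {j : Fin n // j ≠ i}, S.Nonempty →
      ((∑ j ∈ S, omitEntry a i j : ℕ) : ResidueField A) ≠ 0)
    (hN : ∀ m, 1 ≤ m → m ≤ Fintype.card {j : Fin n // j ≠ i} → (m : ResidueField A) ≠ 0)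
    (hx0 : (x : F) ≠ 0)
    (hx : (x : F) ^ Fintype.card {j : Fin n // j ≠ i} =
      (-1) ^ Fintype.card {j : Fin n // j ≠ i} * ((∑ j, a j : ℕ) : F))
    {β γ γ' : F[X]} (h : CongruentModels A a i x β γ) (h' : CongruentModels A a i x β γ') : γ = γ' := by
  obtain ⟨y, z, hy, hz, hyz, rfl, rfl⟩ := h
  obtain ⟨y', z', hy', hz', hyz', hβ, rfl⟩ := h'
  have hpoly : (1 - X : F[X]) ≠ 0 := fun h => by simpa using congrArg (eval 0) h
  rw [treePoly_shiftedTuple, treePoly_shiftedTuple] at hβ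
  -- Cancelling the factor of index `i` keeps the permutation on the indices `j ≠ i`.
  have hβ' := mul_left_cancel₀ (pow_ne_zero _ hpoly) hβ
  have hdist : ∀ {y : {j : Fin n // j ≠ i} → A}, (∀ m, 1 ≤ m →
      m ≤ Fintype.card {j : Fin n // j ≠ i} → weightedPowerSum (omitEntry a i) y m =
        deformedTarget x (Fintype.card {j : Fin n // j ≠ i}) m) →
      (∀ j, 1 + (x : F) * (y j : F) ≠ 0) ∧ Function.Injective fun j => 1 + (x : F) * (y j : F) := by
    intro y hy
    obtain ⟨h1, h2⟩ := shiftedTuple_injective_and_ne_zero a i (card_subtype_ne_add_one i) ha hx _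
      (coe_weightedPowerSum_eq_deformedTarget hy)
    refine ⟨fun j => ?_, fun j l hjl => ?_⟩
    · have := h2 j
      rwa [shiftedTuple_coe] at this
    · apply Subtype.ext
      apply h1
      rw [shiftedTuple_coe, shiftedTuple_coe]
      exact hjl
  obtain ⟨π, hπ, hπy⟩ := exists_perm_of_treePoly_eq (omitEntry a i) (fun j => (ha j).ne') _ _
    (hdist hy).1 (hdist hy).2 (hdist hy').1 (hdist hy').2 hβ'
  have hy'y : ∀ j, y' j = y (π j) := fun j => Subtype.ext <| by
    have := congrFun hπy j
    simpa [hx0] using this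
  have := eq_comp_perm_of_residue_eq hS hN (fun m _ _ => map_kummerTarget _ _ m) hz hz' π hπ
    fun j => by rw [← hyz', hy'y, hyz]
  rw [this]
  exact (treePoly_comp_perm (omitEntry a i) (fun j => (z j : F)) π hπ).symm

theorem CongruentModels.eq_left [Nonempty {j : Fin n // j ≠ i}] [CharZero F] (ha : ∀ j, 0 < a j)
    (hS : ∀ S : Finset {j : Fin n // j ≠ i}, S.Nonempty →
      ((∑ j ∈ S, omitEntry a i j : ℕ) : ResidueField A) ≠ 0)
    (hN : ∀ m, 1 ≤ m → m ≤ Fintype.card {j : Fin n // j ≠ i} → (m : ResidueField A) ≠ 0)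
    (hxres : residue A x = 0)
    {β β' γ : F[X]} (h : CongruentModels A a i x β γ) (h' : CongruentModels A a i x β' γ) : β = β' := by
  obtain ⟨y, z, hy, hz, hyz, rfl, rfl⟩ := h
  obtain ⟨y', z', hy', hz', hyz', rfl, hγ⟩ := h'
  have hdist : ∀ {z : {j : Fin n // j ≠ i} → A}, (∀ m, 1 ≤ m →
      m ≤ Fintype.card {j : Fin n // j ≠ i} → weightedPowerSum (omitEntry a i) z m =
        kummerTarget A (Fintype.card {j : Fin n // j ≠ i}) m) →
      Function.Injective (fun j => (z j : F)) ∧ ∀ j, (z j : F) ≠ 0 := by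
    intro z hz
    have := (weightedPowerSum_eq_kummerTarget_iff _ _).mp (coe_weightedPowerSum_eq_kummerTarget hz)
    exact injective_and_ne_zero_of_weightedPowerSum_eq_one (omitEntry a i)
      (sum_cast_ne_zero (omitEntry a i) fun j => ha j) _
      this.1 this.2
  obtain ⟨π, hπ, hπz⟩ := exists_perm_of_treePoly_eq (omitEntry a i) (fun j => (ha j).ne') _ _
    (hdist hz).2 (hdist hz).1 (hdist hz').2 (hdist hz').1 hγ
  have hz'z : ∀ j, z' j = z (π j) := fun j => Subtype.ext (congrFun hπz j)
  have := eq_comp_perm_of_residue_eq hS hN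
    (fun m _ h2 => by rw [map_deformedTarget, hxres, deformedTarget_zero h2]) hy hy' π hπ
    fun j => by rw [hyz', hz'z, hyz]
  rw [this, treePoly_shiftedTuple, treePoly_shiftedTuple]
  congr 1
  exact (treePoly_comp_perm (omitEntry a i) (fun j => 1 + (x : F) * (y j : F)) π hπ).symm

end Correspondence

/-! ### Compatibility with the decomposition group. -/

section Equivariance

open IsLocalRing

theorem coeff_treePoly_mem_of_shiftedTuple_inv_mem {n : ℕ} {a : Fin n → ℕ} {i : Fin n}
    {K : IntermediateField ℚ Qbar} {A : ValuationSubring Qbar} {x : A} (ha : ∀ j, 0 < a j) (hxK : (x : Qbar) ∈ K)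
    (hx0 : (x : Qbar) ≠ 0) (y : {j : Fin n // j ≠ i} → A)
    (h0 : ∀ j, shiftedTuple i (x : Qbar) (fun j => (y j : Qbar)) j ≠ 0)
    (hroots : ∀ r : Qbar, (treePoly a (shiftedTuple i (x : Qbar) fun j => (y j : Qbar))).eval r = 0 →
      r ∈ K) (k : ℕ) : (treePoly (omitEntry a i) fun j => (y j : Qbar)).coeff k ∈ K := by
  have hyK : ∀ j, (y j : Qbar) ∈ K := by
    intro j
    have h1 : (shiftedTuple i (x : Qbar) (fun j => (y j : Qbar)) j)⁻¹ ∈ K :=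
      hroots _ ((eval_treePoly_eq_zero_iff a (fun j => (ha j).ne') _ _).mpr
        ⟨j, mul_inv_cancel₀ (h0 j)⟩)
    have h2 := inv_mem h1
    rw [inv_inv, shiftedTuple_coe] at h2
    have h3 := mul_mem (inv_mem hxK) (sub_mem h2 (one_mem K))
    rwa [add_sub_cancel_left, inv_mul_cancel_left₀ hx0] at h3
  have : treePoly (omitEntry a i) (fun j => (y j : Qbar)) =
      (treePoly (omitEntry a i) fun j => (⟨y j, hyK j⟩ : K)).map (algebraMap K Qbar) := by
    rw [map_treePoly]
    rfl
  rw [this, coeff_map]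
  exact Subtype.prop _

variable {n : ℕ} {a : Fin n → ℕ} {i : Fin n} {K : IntermediateField ℚ Qbar} [NumberField K]
  {𝔭 : HeightOneSpectrum (𝓞 K)} {A : ValuationSubring Qbar} {x : A}

/-- Since `σ` may move `A`, only congruences between elements of `K` can be transported, through the
action of `τ` on `𝔭`. -/
theorem exists_residue_eq_zero_of_mem_stabilizer (hA : A.comap (algebraMap K Qbar) = localRingAt K 𝔭)
    (τ : K ≃ₐ[ℚ] K) (hτ : τ ∈ MulAction.stabilizer (K ≃ₐ[ℚ] K) 𝔭.asIdeal) (σ : Qbar ≃ₐ[ℚ] Qbar)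
    (hσ : ∀ z : K, σ (z : Qbar) = (τ z : Qbar)) (t : A) (htK : (t : Qbar) ∈ K)
    (ht : residue A t = 0) : ∃ t' : A, (t' : Qbar) = σ t ∧ residue A t' = 0 := by
  have h1 := (residue_eq_zero_iff_valuation_lt_one hA ⟨t, htK⟩ t.2).mp ht
  have h2 := valuation_lt_one_of_mem_stabilizer τ hτ _ h1
  have hmem : ((τ ⟨t, htK⟩ : K) : Qbar) ∈ A := by
    rw [← mem_localRingAt_iff hA, Valuation.mem_valuationSubring_iff]
    exact h2.le
  exact ⟨⟨_, hmem⟩, (hσ ⟨t, htK⟩).symm, (residue_eq_zero_iff_valuation_lt_one hA _ hmem).mpr h2⟩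

/-- Integrality of the conjugates comes from the equations they satisfy, not from stability of `A`
under `σ`. -/
theorem exists_integral_conjugate {J : Type*} [Fintype J] {b : J → ℕ}
    (hS : ∀ S : Finset J, S.Nonempty → ((∑ j ∈ S, b j : ℕ) : ResidueField A) ≠ 0)
    (σ : Qbar ≃ₐ[ℚ] Qbar) (η : Qbar) (y : J → A) (c c' : ℕ → A)
    (hy : ∀ m, 1 ≤ m → m ≤ Fintype.card J → weightedPowerSum b y m = c m)
    (hc : ∀ m, 1 ≤ m → m ≤ Fintype.card J → η ^ m * σ (c m) = c' m) :
    ∃ w : J → A, (∀ j, (w j : Qbar) = η * σ (y j)) ∧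
      ∀ m, 1 ≤ m → m ≤ Fintype.card J → weightedPowerSum b w m = c' m := by
  refine exists_coe_eq_of_weightedPowerSum_eq A b hS (fun j => η * σ (y j)) c' fun m h1 h2 => ?_
  rw [weightedPowerSum_mul, ← map_weightedPowerSum, ← coe_weightedPowerSum, hy m h1 h2, hc m h1 h2]

theorem CongruentModels.twistedAction [Nonempty {j : Fin n // j ≠ i}] (ha : ∀ j, 0 < a j)
    (hS : ∀ S : Finset {j : Fin n // j ≠ i}, S.Nonempty →
      ((∑ j ∈ S, omitEntry a i j : ℕ) : ResidueField A) ≠ 0)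
    (hxres : residue A x = 0) (hx0 : (x : Qbar) ≠ 0)
    (hx : (x : Qbar) ^ Fintype.card {j : Fin n // j ≠ i} =
      (-1) ^ Fintype.card {j : Fin n // j ≠ i} * ((∑ j, a j : ℕ) : Qbar))
    (hK : classSplittingField a ≤ K) (hK' : classKummerField (omitEntry a i) ≤ K)
    (hxK : (x : Qbar) ∈ K)
    (hA : A.comap (algebraMap K Qbar) = localRingAt K 𝔭)
    (τ : K ≃ₐ[ℚ] K) (hτ : τ ∈ MulAction.stabilizer (K ≃ₐ[ℚ] K) 𝔭.asIdeal) (σ : Qbar ≃ₐ[ℚ] Qbar)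
    (hσ : ∀ z : K, σ (z : Qbar) = (τ z : Qbar)) {β γ : Qbar[X]} (h : CongruentModels A a i x β γ) :
    CongruentModels A a i x (β.map (σ : Qbar →+* Qbar)) (_root_.twistedAction x σ γ) := by
  have hβ := h.isNormalizedModelAt ha hx
  have hγ := h.isKummerModel ha
  obtain ⟨y, z, hy, hz, hyz, rfl, rfl⟩ := h
  set N := Fintype.card {j : Fin n // j ≠ i} with hNdef
  set b := omitEntry a i with hb
  have hσx : σ (x : Qbar) ≠ 0 := (_root_.map_ne_zero σ).mpr hx0
  have hσxN : σ (x : Qbar) ^ N = (x : Qbar) ^ N := by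
    rw [← map_pow, hx]
    simp
  set η : Qbar := σ x / x with hη
  have hηx : η * x = σ x := div_mul_cancel₀ _ hx0
  have hη1 : η ^ N = 1 := by
    rw [hη, div_pow, hσxN, div_self (pow_ne_zero _ hx0)]
  -- The factor `η` is an `N`-th root of unity because `x ^ N` is rational; so it is integral, and
  -- twisting by it preserves both systems.
  have hN0 : N ≠ 0 := Fintype.card_ne_zero
  obtain ⟨e, he⟩ : ∃ e : A, (e : Qbar) = η :=
    (IsIntegrallyClosed.isIntegral_iff (R := A)).mp (IsIntegral.of_pow (n := N) (Nat.pos_of_ne_zero hN0)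
      (by rw [hη1]; exact isIntegral_one))
  obtain ⟨y', hy', hy'φ⟩ := exists_integral_conjugate hS σ η y _
    (deformedTarget x N) hy fun m h1 h2 => by
      have e1 : ((deformedTarget x N m : A) : Qbar) = deformedTarget (x : Qbar) N m :=
        map_deformedTarget A.subtype x N m
      rw [e1, deformedTarget, map_mul, map_pow, map_pow, map_neg, map_one, mul_left_comm]
      congr 1
      refine mul_left_cancel₀ (pow_ne_zero m hx0) ?_
      rw [← mul_assoc, ← mul_pow, mul_comm (x : Qbar), hηx, ← pow_add, ← pow_add,
        Nat.add_sub_cancel' h2, hσxN]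
  obtain ⟨z', hz', hz'φ⟩ := exists_integral_conjugate hS σ η z _
    (kummerTarget A N) hz fun m h1 h2 => by
      unfold kummerTarget
      split_ifs with hm
      · simp [hm, hη1]
      · simp
  have hyK := coeff_treePoly_mem_of_shiftedTuple_inv_mem ha hxK hx0 y
    (shiftedTuple_injective_and_ne_zero a i (card_subtype_ne_add_one i) ha hx _
      (coe_weightedPowerSum_eq_deformedTarget hy)).2 fun r hr =>
        hK (IntermediateField.subset_adjoin ℚ _ ⟨_, hβ.1, hr⟩)
  have hzK : ∀ k, (treePoly b fun j => (z j : Qbar)).coeff k ∈ K := fun k =>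
    hK' (coeff_mem_classKummerField b (fun j => ha j) _ hγ k)
  have hcoe : ∀ (w : {j : Fin n // j ≠ i} → A) (k : ℕ),
      (((treePoly b w).coeff k : A) : Qbar) = (treePoly b fun j => (w j : Qbar)).coeff k :=
    fun w k => by
      change algebraMap A Qbar _ = _
      rw [← coeff_map, map_treePoly]
      rfl
  have hconj : ∀ (w w' : {j : Fin n // j ≠ i} → A), (∀ j, (w' j : Qbar) = η * σ (w j)) → ∀ k,
      (((treePoly b w').coeff k : A) : Qbar) = η ^ k * σ ((treePoly b w).coeff k : A) :=
    fun w w' hw k => by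
      rw [hcoe, hcoe]
      simp only [hw]
      rw [← treePoly_comp_C_mul_X, comp_C_mul_X_coeff, mul_comm]
      congr 1
      exact (congrArg (fun f : Qbar[X] => f.coeff k)
        (map_treePoly (σ : Qbar →+* Qbar) b fun j => (w j : Qbar))).symm.trans (coeff_map _ _)
  -- The individual `z j` need not lie in `K`, so the congruence is transported on the coefficients
  -- of the two polynomials, which do.
  have hcongr : treePoly b (fun j => residue A (z' j)) = treePoly b fun j => residue A (y' j) := by
    ext k
    rw [← map_treePoly, ← map_treePoly, coeff_map, coeff_map, ← sub_eq_zero, ← map_sub]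
    obtain ⟨t, ht, ht0⟩ := exists_residue_eq_zero_of_mem_stabilizer hA τ hτ σ hσ
      ((treePoly b z).coeff k - (treePoly b y).coeff k) (by
        change ((treePoly b z).coeff k : Qbar) - ((treePoly b y).coeff k : Qbar) ∈ K
        rw [hcoe, hcoe]
        exact sub_mem (hzK k) (hyK k)) (by
        rw [map_sub, ← coeff_map, ← coeff_map, map_treePoly, map_treePoly]
        simp only [hyz, sub_self])
    have : (treePoly b z').coeff k - (treePoly b y').coeff k = e ^ k * t := Subtype.ext <| by
      change ((treePoly b z').coeff k : Qbar) - ((treePoly b y').coeff k : Qbar) = (e : Qbar) ^ k * t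
      rw [hconj z z' hz', hconj y y' hy', ht, he, ← mul_sub]
      congr 1
      exact (map_sub σ _ _).symm
    rw [this, map_mul, ht0, mul_zero]
  have hyres := weightedPowerSum_residue_of_deformedTarget hxres hy'φ
  have hzres := weightedPowerSum_residue_eq_kummerTarget A b z' hz'φ
  rw [weightedPowerSum_eq_kummerTarget_iff] at hyres hzres
  have hyd := injective_and_ne_zero_of_weightedPowerSum_eq_one b hS _ hyres.1 hyres.2
  have hzd := injective_and_ne_zero_of_weightedPowerSum_eq_one b hS _ hzres.1 hzres.2
  -- Both residue tuples have distinct nonzero entries, so equal polynomials give equal tuples up to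
  -- `π`; reordering the `z' j` absorbs it.
  obtain ⟨π, hπ, hπy⟩ := exists_perm_of_treePoly_eq b (fun j => (ha j).ne') _ _ hzd.2 hzd.1 hyd.2 hyd.1
    hcongr
  refine ⟨y', z' ∘ π, hy'φ, fun m h1 h2 => ?_, fun j => congrFun hπy j, ?_, ?_⟩
  · rw [weightedPowerSum_comp_perm b z' m π hπ, hz'φ m h1 h2]
  · rw [map_treePoly]
    refine congrArg _ (funext fun j => ?_)
    rw [map_shiftedTuple]
    unfold shiftedTuple
    split_ifs with hj
    · rfl
    · change 1 + σ x * σ (y ⟨j, hj⟩) = 1 + (x : Qbar) * (y' ⟨j, hj⟩ : Qbar)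
      rw [hy', ← hηx]
      ring
  · rw [_root_.twistedAction, map_treePoly, treePoly_comp_C_mul_X]
    refine Eq.trans ?_ (treePoly_comp_perm b (fun j => (z' j : Qbar)) π hπ).symm
    exact congrArg _ (funext fun j => (hz' j).symm)

end Equivariance

/-! ### Regularity at infinity and the conclusion. -/

section RegularPrime

theorem not_dvd_sum_omitEntry {n p : ℕ} {a : Fin n → ℕ} (hreg : RegularAtInfinity p a) (i : Fin n)
    (S : Finset {j : Fin n // j ≠ i}) (hS : S.Nonempty) : ¬ p ∣ ∑ j ∈ S, omitEntry a i j := by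
  intro h
  refine hreg.2 (h.trans ?_)
  have hmap : ∑ j ∈ S, omitEntry a i j = ∑ j ∈ S.map (Function.Embedding.subtype _), a j := by
    rw [Finset.sum_map]
    rfl
  rw [hmap, dInfinity]
  refine Finset.dvd_prod_of_mem (fun S : Finset (Fin n) => ∑ j ∈ S, a j) ?_
  rw [Finset.mem_filter]
  refine ⟨Finset.mem_univ _, hS.map, fun h => ?_⟩
  have := h ▸ Finset.mem_univ i
  simp at this

theorem pow_eq_of_aeval_hInfinity_eq_zero {n N : ℕ} {a : Fin n → ℕ} (hN : N + 1 = n) {x : Qbar}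
    (hx : aeval x (hInfinity a) = 0) : x ^ N = (-1) ^ N * ((∑ j, a j : ℕ) : Qbar) := by
  subst hN
  rw [hInfinity, map_add, map_pow, aeval_X, aeval_C, Nat.add_sub_cancel] at hx
  rw [eq_neg_of_add_eq_zero_left hx]
  simp [pow_succ]

end RegularPrime

theorem theorem9p5 {n : ℕ} (a : Fin n → ℕ) (ha : ∀ j, 0 < a j)
    (p : ℕ) (hp : p.Prime) (hpn : n < p) (hreg : RegularAtInfinity p a) (i : Fin n)
    (K : IntermediateField ℚ Qbar) [NumberField K]
    (hK : classSplittingField a ≤ K)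
    (hK' : classKummerField (omitEntry a i) ≤ K)
    (hKh : IntermediateField.adjoin ℚ ((hInfinity a).rootSet Qbar) ≤ K)
    (x : Qbar) (hx : aeval x (hInfinity a) = 0)
    (𝔭 : HeightOneSpectrum (𝓞 K)) (h𝔭 : 𝔭.asIdeal.LiesOver (Ideal.span {(p : ℤ)})) :
    (∃ Ψ : Qbar[X] → Qbar[X],
      Set.BijOn Ψ {β | IsNormalizedModelAt a i β} {γ | IsKummerModel (omitEntry a i) γ} ∧
      -- `τ` runs through the decomposition group of `𝔭`, and `σ` through its extensions to `Qbar`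
      ∀ τ ∈ MulAction.stabilizer (K ≃ₐ[ℚ] K) 𝔭.asIdeal, ∀ σ : Qbar ≃ₐ[ℚ] Qbar,
        (∀ z : K, σ (z : Qbar) = (τ z : Qbar)) →
          ∀ β : Qbar[X], IsNormalizedModelAt a i β →
            Ψ (β.map (σ : Qbar →+* Qbar)) = twistedAction x σ (Ψ β)) ∧
    (∀ β : Qbar[X], IsModel (omitEntry a i) β → HasGoodReduction K 𝔭 (omitEntry a i) β) ∧
    (∀ γ : Qbar[X], IsKummerModel (omitEntry a i) γ →
      ReducesToKummerModel K 𝔭 (omitEntry a i) γ) := by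
  classical
  have hcard := card_subtype_ne_add_one i
  have hxN := pow_eq_of_aeval_hInfinity_eq_zero hcard hx
  have hsum : 0 < ∑ j, a j := Finset.sum_pos (fun j _ => ha j) ⟨i, Finset.mem_univ i⟩
  -- For `n = 1` a root of the constant `1 - a_1` exists only if `a_1 = 1`, which `p` does not
  -- divide.
  have hN0 : Fintype.card {j : Fin n // j ≠ i} ≠ 0 := by
    intro h0
    rw [h0, pow_zero, pow_zero, one_mul] at hxN
    have h1 : ∑ j, a j = 1 := by exact_mod_cast hxN.symm
    have := hreg.1
    rw [h1] at this
    exact hp.one_lt.ne' (Nat.dvd_one.mp this)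
  have hne : Nonempty {j : Fin n // j ≠ i} := Fintype.card_pos_iff.mp (Nat.pos_of_ne_zero hN0)
  have hx0 : x ≠ 0 := by
    rintro rfl
    rw [zero_pow hN0, eq_comm, mul_eq_zero] at hxN
    rcases hxN with h | h
    · exact pow_ne_zero _ (neg_ne_zero.mpr one_ne_zero) h
    · exact hsum.ne' (by exact_mod_cast h)
  have hxK : x ∈ K := by
    refine hKh (IntermediateField.subset_adjoin ℚ _ ?_)
    rw [mem_rootSet]
    refine ⟨fun h0 => ?_, hx⟩
    have h1 := congrArg (fun f : ℚ[X] => f.coeff (n - 1)) h0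
    have h2 : n - 1 ≠ 0 := by omega
    simp only [hInfinity, coeff_add, coeff_X_pow_self, coeff_C_of_ne_zero h2, coeff_zero] at h1
    simp at h1
  have hreduction : ∀ A : ValuationSubring Qbar, A.comap (algebraMap K Qbar) = localRingAt K 𝔭 →
      ∀ m : ℕ, ((m : IsLocalRing.ResidueField A) = 0 ↔ p ∣ m) := fun A hA m => by
    have := (CharP.charP_iff_prime_eq_zero hp).mpr (natCast_residueField_eq_zero hA h𝔭)
    exact CharP.cast_eq_zero_iff _ p m
  have hS : ∀ A : ValuationSubring Qbar, A.comap (algebraMap K Qbar) = localRingAt K 𝔭 →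
      ∀ S : Finset {j : Fin n // j ≠ i}, S.Nonempty →
        ((∑ j ∈ S, omitEntry a i j : ℕ) : IsLocalRing.ResidueField A) ≠ 0 := fun A hA S hne => by
    rw [Ne, hreduction A hA]
    exact not_dvd_sum_omitEntry hreg i S hne
  have hN : ∀ A : ValuationSubring Qbar, A.comap (algebraMap K Qbar) = localRingAt K 𝔭 →
      ∀ m, 1 ≤ m → m ≤ Fintype.card {j : Fin n // j ≠ i} →
        (m : IsLocalRing.ResidueField A) ≠ 0 := fun A hA m h1 h2 => by
    rw [Ne, hreduction A hA]
    exact Nat.not_dvd_of_pos_of_lt h1 (by omega)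
  -- One place above `𝔭` is fixed to define `Ψ`; good reduction is checked at every such place.
  obtain ⟨A, hA⟩ := exists_valuationSubring_comap_eq K 𝔭
  refine ⟨?_, fun β hβ B hB => exists_normalizedModel_reduction B (omitEntry a i) (fun j => ha j) (hS B hB) (hN B hB)
    β hβ, fun γ hγ => reducesToKummerModel_of_coeff_mem (omitEntry a i) (fun j => ha j) hA (hS A hA) (hN A hA) γ hγ
    fun k => hK' (coeff_mem_classKummerField (omitEntry a i) (fun j => ha j) γ hγ k)⟩
  obtain ⟨xA, rfl⟩ : ∃ xA : A, (xA : Qbar) = x :=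
    (IsIntegrallyClosed.isIntegral_iff (R := A)).mp (IsIntegral.of_pow (Nat.pos_of_ne_zero hN0) (by
      rw [hxN]
      exact (isIntegral_one.neg.pow _).mul (isIntegral_algebraMap (x := ((∑ j, a j : ℕ) : A)))))
  -- Here `p ∣ ∑ a_j` enters: `x ^ N` has residue `0`.
  have hxres : IsLocalRing.residue A xA = 0 := by
    refine (pow_eq_zero_iff hN0).mp ?_
    have : xA ^ Fintype.card {j : Fin n // j ≠ i} =
        (-1) ^ Fintype.card {j : Fin n // j ≠ i} * ((∑ j, a j : ℕ) : A) :=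
      Subtype.ext (by simpa using hxN)
    rw [← map_pow, this, map_mul, map_natCast, (hreduction A hA _).mpr hreg.1, mul_zero]
  have hex : ∀ β, IsNormalizedModelAt a i β → ∃ γ, CongruentModels A a i xA β γ := fun β hβ =>
    exists_congruentModels_of_isNormalizedModelAt ha (hS A hA) hxres hx0 hxN β hβ
  -- The choice is harmless: `huniq` characterizes the values of `Ψ` by congruence, which then
  -- yields surjectivity and equivariance.
  choose! Ψ hΨ using hex
  have huniq : ∀ {β γ γ'}, CongruentModels A a i xA β γ → CongruentModels A a i xA β γ' → γ = γ' :=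
    fun h h' => h.eq_right ha (hS A hA) (hN A hA) hx0 hxN h'
  refine ⟨Ψ, ⟨fun β hβ => (hΨ β hβ).isKummerModel ha, fun β hβ β' hβ' h => ?_, fun γ hγ => ?_⟩,
    fun τ hτ σ hσ β hβ => ?_⟩
  · have h' := hΨ β' hβ'
    rw [← h] at h'
    exact (hΨ β hβ).eq_left ha (hS A hA) (hN A hA) hxres h'
  · obtain ⟨β, h⟩ := exists_congruentModels_of_isKummerModel (hS A hA) hxres γ hγ
    have hβ := h.isNormalizedModelAt ha hxN
    exact ⟨β, hβ, huniq (hΨ β hβ) h⟩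
  · have h := (hΨ β hβ).twistedAction ha (hS A hA) hxres hx0 hxN hK hK' hxK hA τ hτ σ hσ
    exact huniq (hΨ _ (h.isNormalizedModelAt ha hxN)) h

end
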